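/- There exist absolute constants $C_1,C_2>0$ such that the following holds. Let $n\ge 2$, let $x\ge 1$ be an integer, let $C_0\ge 1$ be real, and let $X_1,\dots,X_n$ be identically distributed, non-negative integer-valued random variables that are 1-dependent, i.e. for all $1\le s<t\le n$ with $t-s>1$ the $\sigma$-algebras generated by $X_1,\dots,X_s$ and by $X_t,\dots,X_n$ are independent. Put $S_n=X_1+\dots+X_n$, $$\nu_1=\mathbb E X_1,\qquad \nu_2=\mathbb E X_1(X_1-1),\qquad y=\frac{x-n\nu_1}{n\nu_1},\qquad \gamma=e^{1.5C_0}\max(\nu_1^2,\nu_2,\mathbb E X_1X_2),$$ $$\Lambda(y)=-n(1-\nu_1)\sum_{j=2}^\infty\Big(\frac{\nu_1}{1-\nu_1}\Big)^j\frac{y^j}{j(j-1)} .$$ Assume that $\nu_1>0$, that $\mathbb E X_jX_{j+1}\le \mathbb E X_1X_2$ for all $1\le j<n$ (which holds in particular if $\mathbb E X_jX_{j+1}$ does not depend on $j$), and that $$X_1\le C_0 \text{ almost surely},\qquad e^{5C_0}\nu_1\le 0.002,\qquad |y|\le \tfrac1{10},$$ $$\nu_2\le \frac{\nu_1e^{-1.5C_0}}{20},\qquad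 \mathbb E X_1X_2\le\frac{\nu_1e^{-1.5C_0}}{20}.$$ Let $Z_n$ be a Poisson random variable with parameter $n\nu_1$. Then $$\frac{P(S_n=x)}{P(Z_n=x)}=e^{\Lambda(y)}\,(1+C_1\gamma y^2)^n\,\Big(1+\theta C_2\gamma\big(\nu_1^{-1}+ny^2\big)\Big)$$ for some real number $\theta$ with $|\theta|\le 1$. -/

import Mathlib

open MeasureTheory ProbabilityTheory

noncomputable section

/-- The random variables `X 1, …, X n` are `m`-dependent: whenever `1 ≤ s`, `t ≤ n` and
`t - s > m`, the sigma-algebras generated by `X 1, …, X s` and by `X t, …, X n` are independent.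
Only the variables with index in `{1, …, n}` matter. -/
def IsMDependent {Ω : Type*} [MeasurableSpace Ω] (m n : ℕ) (X : ℕ → Ω → ℕ) (P : Measure Ω) :
    Prop :=
  ∀ s t : ℕ, 1 ≤ s → s + m < t → t ≤ n →
    Indep (⨆ i ∈ Set.Icc 1 s, MeasurableSpace.comap (X i) ⊤)
      (⨆ i ∈ Set.Icc t n, MeasurableSpace.comap (X i) ⊤) P

/-- The Cramér-type series
`Λ(y) = -n (1 - ν₁) ∑_{j ≥ 2} (ν₁ / (1 - ν₁)) ^ j * y ^ j / (j (j - 1))`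
(the summation index is shifted by two). -/
def cramerSeries (n : ℕ) (ν₁ y : ℝ) : ℝ :=
  -(n : ℝ) * (1 - ν₁) *
    ∑' k : ℕ, (ν₁ / (1 - ν₁)) ^ (k + 2) * (y ^ (k + 2) / (((k : ℝ) + 2) * ((k : ℝ) + 1)))

end

/-!
By 1-dependence, `F k = E ∏_{i ≤ k} z ^ X i` satisfies a linear recursion whose correction terms are
expectations of products of consecutive factors `z ^ X i - 1`. On the circle `|z| = 1 + y ≤ 11/10`
these decay geometrically in the length of the block, so that each quotient `F (k + 1) / F k` is
`exp (ν₁ (z - 1)) (1 + O(γ |z - 1|²))`.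

The radius `1 + y = x / (n ν₁)` is the saddle point of `exp (n ν₁ (z - 1)) / z ^ x`. There the
integrand of Cauchy's formula for `P(S_n = x) - P(Z_n = x)` is, up to its value at the saddle point,
dominated by `n γ |z - 1|²` times a Gaussian of variance of order `1 / (n ν₁)` in the angle, and
Stirling's formula bounds `P(Z_n = x)` from below by the matching Gaussian mass. This gives a
relative error of order `γ (1 / ν₁ + n y²) exp (O(n γ y²))`. Since `|Λ(y)| ≤ n γ y²`, a large enough
`C₁` makes `exp (Λ(y)) (1 + C₁ γ y²) ^ n` lie between `exp (19 n γ y²)` and `exp (41 n γ y²)`, and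
this factor absorbs the exponential.
-/

section GeneratingFunction

open Complex
open scoped Real

/-- The probability generating function `z ↦ ∑ k, μ {k} * z ^ k` of a law `μ` on `ℕ`, as a function
of a complex variable; it takes the junk value `0` where `k ↦ z ^ k` is not integrable. -/
noncomputable def pgf (μ : Measure ℕ) (z : ℂ) : ℂ :=
  ∫ k, z ^ k ∂μ

theorem pgf_map {Ω : Type*} [MeasurableSpace Ω] {P : Measure Ω} {S : Ω → ℕ} (hS : AEMeasurable S P)
    (z : ℂ) : pgf (P.map S) z = ∫ ω, z ^ S ω ∂P :=
  integral_map hS (by fun_prop)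

theorem intervalIntegral_exp_int_mul_mul_I (m : ℤ) :
    ∫ t in (-π)..π, exp (m * t * I) = if m = 0 then (2 * π : ℂ) else 0 := by
  split_ifs with hm
  · simp [hm, two_mul]
  · have hmI : (m : ℂ) * I ≠ 0 := mul_ne_zero (mod_cast hm) I_ne_zero
    have hperiod : exp (m * I * (π : ℝ)) = exp (m * I * ((-π : ℝ) : ℂ)) :=
      exp_eq_exp_iff_exists_int.2 ⟨m, by push_cast; ring⟩
    simp_rw [mul_right_comm _ _ I]
    rw [integral_exp_mul_complex hmI, hperiod, sub_self, zero_div]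

theorem intervalIntegral_circleMap_pow_mul_exp (r : ℝ) (k x : ℕ) :
    ∫ t in (-π)..π, circleMap 0 r t ^ k * exp (-(x * t) * I) =
      if k = x then (2 * π * r ^ x : ℂ) else 0 := by
  have hmode (t : ℝ) : circleMap 0 r t ^ k * exp (-(x * t) * I) =
      r ^ k * exp (((k - x : ℤ) : ℂ) * t * I) := by
    rw [circleMap_zero, mul_pow, ← exp_nat_mul, mul_assoc, ← exp_add]
    congr 2
    push_cast
    ring
  simp_rw [hmode, intervalIntegral.integral_const_mul, intervalIntegral_exp_int_mul_mul_I,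
    sub_eq_zero, Nat.cast_inj]
  split_ifs with h
  · rw [h, mul_comm]
  · rw [mul_zero]

theorem norm_exp_neg_natCast_mul_mul_I (x : ℕ) (t : ℝ) : ‖exp (-(x * t) * I)‖ = 1 := by
  simpa using norm_exp_ofReal_mul_I (-(x * t))

theorem two_pi_mul_measureReal_singleton (μ : Measure ℕ) [IsFiniteMeasure μ] {r : ℝ}
    (hr : Integrable (fun k : ℕ => r ^ k) μ) (x : ℕ) :
    2 * π * r ^ x * μ.real {x} =
      ∫ t in (-π)..π, pgf μ (circleMap 0 r t) * exp (-(x * t) * I) := by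
  have hfubini : Integrable (Function.uncurry fun (t : ℝ) (k : ℕ) =>
      circleMap 0 r t ^ k * exp (-(x * t) * I))
      ((volume.restrict (Set.Ioc (-π) π)).prod μ) := by
    refine ((integrable_const (1 : ℝ)).mul_prod hr.norm).mono' ?_ (.of_forall fun p => ?_)
    · exact Measurable.aestronglyMeasurable (by unfold circleMap; fun_prop)
    · simp only [Function.uncurry, norm_mul, norm_pow, norm_circleMap_zero,
        norm_exp_neg_natCast_mul_mul_I, one_mul, mul_one, Real.norm_eq_abs, le_refl]
  have hpi : -π ≤ π := by linarith [Real.pi_pos]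
  simp_rw [pgf, ← integral_mul_const]
  rw [intervalIntegral.integral_of_le hpi, integral_integral_swap hfubini]
  simp_rw [← intervalIntegral.integral_of_le hpi, intervalIntegral_circleMap_pow_mul_exp]
  have hindicator : (fun k => if k = x then (2 * π * r ^ x : ℂ) else 0) =
      ({x} : Set ℕ).indicator fun _ => (2 * π * r ^ x : ℂ) := by
    ext k
    simp [Set.indicator]
  rw [hindicator, integral_indicator (measurableSet_singleton x), setIntegral_const, real_smul,
    mul_comm]

theorem continuous_pgf_circleMap {μ : Measure ℕ} {r : ℝ}
    (hr : Integrable (fun k : ℕ => r ^ k) μ) : Continuous fun t => pgf μ (circleMap 0 r t) := by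
  refine continuous_of_dominated (fun t => Measurable.of_discrete.aestronglyMeasurable)
    (fun t => .of_forall fun k => ?_) hr.norm (.of_forall fun k => by fun_prop)
  simp

theorem two_pi_mul_abs_measureReal_singleton_sub_le {μ ν : Measure ℕ} [IsFiniteMeasure μ]
    [IsFiniteMeasure ν] {r : ℝ} (hr : 0 ≤ r) (hμ : Integrable (fun k : ℕ => r ^ k) μ)
    (hν : Integrable (fun k : ℕ => r ^ k) ν) (x : ℕ) :
    2 * π * r ^ x * |μ.real {x} - ν.real {x}| ≤
      ∫ t in (-π)..π, ‖pgf μ (circleMap 0 r t) - pgf ν (circleMap 0 r t)‖ := by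
  have hcμ := continuous_pgf_circleMap hμ
  have hcν := continuous_pgf_circleMap hν
  have hdiff : ((2 * π * r ^ x * (μ.real {x} - ν.real {x}) : ℝ) : ℂ) =
      ∫ t in (-π)..π, (pgf μ (circleMap 0 r t) - pgf ν (circleMap 0 r t)) *
        exp (-(x * t) * I) := by
    simp_rw [sub_mul]
    rw [intervalIntegral.integral_sub (Continuous.intervalIntegrable (by fun_prop) _ _)
      (Continuous.intervalIntegrable (by fun_prop) _ _), ← two_pi_mul_measureReal_singleton μ hμ,
      ← two_pi_mul_measureReal_singleton ν hν]
    push_cast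
    ring
  calc 2 * π * r ^ x * |μ.real {x} - ν.real {x}|
      = ‖((2 * π * r ^ x * (μ.real {x} - ν.real {x}) : ℝ) : ℂ)‖ := by
        rw [norm_real, Real.norm_eq_abs, abs_mul (2 * π * r ^ x),
          abs_of_nonneg (a := 2 * π * r ^ x) (by positivity)]
    _ ≤ ∫ t in (-π)..π, ‖(pgf μ (circleMap 0 r t) - pgf ν (circleMap 0 r t)) *
        exp (-(x * t) * I)‖ := by
        rw [hdiff]
        exact intervalIntegral.norm_integral_le_integral_norm (by linarith [Real.pi_pos])
    _ = _ := by simp_rw [norm_mul, norm_exp_neg_natCast_mul_mul_I, mul_one]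

theorem hasSum_poissonMeasure_pow (l : NNReal) (z : ℂ) :
    HasSum (fun k : ℕ => (Real.exp (-l) * l ^ k / k.factorial) • z ^ k) (exp (l * (z - 1))) := by
  have h := (NormedSpace.expSeries_div_hasSum_exp ((l : ℂ) * z)).mul_left (exp (-l))
  rw [← exp_eq_exp_ℂ, ← exp_add, show -(l : ℂ) + l * z = l * (z - 1) by ring] at h
  refine h.congr_fun fun k => ?_
  rw [real_smul]
  push_cast
  ring

theorem pgf_poissonMeasure (l : NNReal) (z : ℂ) : pgf (poissonMeasure l) z = exp (l * (z - 1)) := by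
  rw [pgf, integral_poissonMeasure, (hasSum_poissonMeasure_pow l z).tsum_eq]

theorem integrable_pow_poissonMeasure (l : NNReal) (r : ℝ) :
    Integrable (fun k : ℕ => r ^ k) (poissonMeasure l) := by
  rw [integrable_poissonMeasure_iff]
  refine ((NormedSpace.expSeries_div_summable (l * |r|)).mul_left (Real.exp (-l))).congr
    fun k => ?_
  rw [norm_pow, Real.norm_eq_abs, mul_pow]
  ring

end GeneratingFunction

section HeinrichRecursion

/-- The recursion behind Heinrich's method for `1`-dependent variables `ξ i`: it is satisfied by
`f k = E ∏ i ≤ k, (1 + ξ i)`, `b k m = E ∏ i ∈ (k, k + m + 1], ξ i`, and the mixed moments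
`T k m = E (∏ i ≤ k, (1 + ξ i)) * ∏ i ∈ (k, k + m + 1], ξ i`. Only indices up to `n` matter. -/
structure IsHeinrichRecursion {R : Type*} [Semiring R] (n : ℕ) (f : ℕ → R) (T b : ℕ → ℕ → R) :
    Prop where
  mixed_zero : ∀ m, m + 1 ≤ n → T 0 m = f 0 * b 0 m
  mixed_succ : ∀ k m, k + 1 + m + 1 ≤ n → T (k + 1) m = f k * b (k + 1) m + T k (m + 1)
  succ : ∀ k, k + 1 ≤ n → f (k + 1) = f k + T k 0

variable {R : Type*} [NormedCommRing R] {n : ℕ} {f : ℕ → R} {T b : ℕ → ℕ → R} {β B : ℕ → ℝ}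

theorem IsHeinrichRecursion.sub_mul_norm_le (h : IsHeinrichRecursion n f T b) {k : ℕ} {c : ℝ}
    (hk : k + 1 ≤ n) (hT : ‖T k 0‖ ≤ c * ‖f k‖) : (1 - c) * ‖f k‖ ≤ ‖f (k + 1)‖ := by
  rw [h.succ k hk]
  linarith [norm_sub_le_norm_add (f k) (T k 0)]

theorem IsHeinrichRecursion.norm_mixed_le (h : IsHeinrichRecursion n f T b)
    (hb : ∀ k m, k + m + 1 ≤ n → ‖b k m‖ ≤ β m) (hβB : ∀ m, β m ≤ B m)
    (hB : ∀ m, β m + B (m + 1) ≤ (1 - B 0) * B m) {k m : ℕ} (hkm : k + m + 1 ≤ n) :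
    ‖T k m‖ ≤ B m * ‖f k‖ := by
  have hbB {k m : ℕ} (hkm : k + m + 1 ≤ n) : ‖b k m‖ ≤ B m := (hb k m hkm).trans (hβB m)
  induction k generalizing m with
  | zero =>
    rw [h.mixed_zero m (by omega), mul_comm (B m)]
    exact (norm_mul_le _ _).trans (by gcongr; exact hbB hkm)
  | succ k ih =>
    have hf : (1 - B 0) * ‖f k‖ ≤ ‖f (k + 1)‖ := h.sub_mul_norm_le (by omega) (ih (by omega))
    have hBm : 0 ≤ B m := (norm_nonneg _).trans (hbB hkm)
    calc ‖T (k + 1) m‖ ≤ ‖f k‖ * ‖b (k + 1) m‖ + ‖T k (m + 1)‖ := by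
          rw [h.mixed_succ k m hkm]
          exact (norm_add_le _ _).trans (by gcongr; exact norm_mul_le _ _)
      _ ≤ ‖f k‖ * β m + B (m + 1) * ‖f k‖ := by
          gcongr
          · exact hb (k + 1) m hkm
          · exact ih (by omega)
      _ ≤ (1 - B 0) * B m * ‖f k‖ := by
          linarith [mul_le_mul_of_nonneg_right (hB m) (norm_nonneg (f k))]
      _ = B m * ((1 - B 0) * ‖f k‖) := by ring
      _ ≤ B m * ‖f (k + 1)‖ := by gcongr

theorem IsHeinrichRecursion.norm_succ_sub_le (h : IsHeinrichRecursion n f T b)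
    (hb : ∀ k m, k + m + 1 ≤ n → ‖b k m‖ ≤ β m) (hβB : ∀ m, β m ≤ B m)
    (hB : ∀ m, β m + B (m + 1) ≤ (1 - B 0) * B m) {κ : ℝ} (hκ : 0 ≤ κ)
    (hBκ : B 1 + β 0 * B 0 ≤ (1 - B 0) * κ) {k : ℕ} (hk : k + 1 ≤ n) :
    ‖f (k + 1) - (1 + b k 0) * f k‖ ≤ κ * ‖f k‖ := by
  rcases k with _ | k
  · have hzero : f (0 + 1) - (1 + b 0 0) * f 0 = 0 := by
      rw [h.succ 0 hk, h.mixed_zero 0 hk]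
      ring
    rw [hzero, norm_zero]
    positivity
  · have hmixed : f (k + 1 + 1) - (1 + b (k + 1) 0) * f (k + 1) = T k 1 - b (k + 1) 0 * T k 0 := by
      rw [h.succ (k + 1) hk, h.mixed_succ k 0 (by omega), h.succ k (by omega)]
      ring
    have hT₀ : ‖T k 0‖ ≤ B 0 * ‖f k‖ := h.norm_mixed_le hb hβB hB (by omega)
    have hT₁ : ‖T k 1‖ ≤ B 1 * ‖f k‖ := h.norm_mixed_le hb hβB hB (by omega)
    have hb₀ : ‖b (k + 1) 0‖ ≤ β 0 := hb (k + 1) 0 (by omega)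
    have hβ₀ : 0 ≤ β 0 := (norm_nonneg _).trans hb₀
    calc ‖f (k + 1 + 1) - (1 + b (k + 1) 0) * f (k + 1)‖
        ≤ ‖T k 1‖ + ‖b (k + 1) 0‖ * ‖T k 0‖ := by
          rw [hmixed]
          exact (norm_sub_le _ _).trans (by gcongr; exact norm_mul_le _ _)
      _ ≤ B 1 * ‖f k‖ + β 0 * (B 0 * ‖f k‖) := by gcongr
      _ ≤ κ * ((1 - B 0) * ‖f k‖) := by
          linarith [mul_le_mul_of_nonneg_right hBκ (norm_nonneg (f k))]
      _ ≤ κ * ‖f (k + 1)‖ := by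
          gcongr
          exact h.sub_mul_norm_le (by omega) hT₀

/-- The sequence `a, q, ρ a, ρ q, ρ² a, ρ² q, …`, which bounds the absolute moments of products of
consecutive `1`-dependent variables. -/
def twoStepGeom (ρ a q : ℝ) : ℕ → ℝ
  | 0 => a
  | 1 => q
  | m + 2 => ρ * twoStepGeom ρ a q m

theorem twoStepGeom_nonneg {ρ a q : ℝ} (hρ : 0 ≤ ρ) (ha : 0 ≤ a) (hq : 0 ≤ q) (m : ℕ) :
    0 ≤ twoStepGeom ρ a q m := by
  induction m using Nat.twoStepInduction with
  | zero => exact ha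
  | one => exact hq
  | more m ih _ => exact mul_nonneg hρ ih

theorem IsHeinrichRecursion.norm_succ_sub_le_of_twoStepGeom (h : IsHeinrichRecursion n f T b)
    {M a q : ℝ} (hM : 2 ≤ M) (ha : 0 ≤ a) (hq : 0 ≤ q) (haM : a * M ≤ 1 / 10)
    (haq : 2 * a + 4 * q ≤ 1 / 10) (hb : ∀ k m, k + m + 1 ≤ n → ‖b k m‖ ≤ twoStepGeom (a * M) a q m)
    {k : ℕ} (hk : k + 1 ≤ n) :
    ‖f (k + 1) - (1 + b k 0) * f k‖ ≤ (3 * q + 6 * a ^ 2 * M) * ‖f k‖ := by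
  have hβ := twoStepGeom_nonneg (mul_nonneg ha (by linarith : 0 ≤ M)) ha hq
  have hstep (m : ℕ) : twoStepGeom (a * M) a q (m + 2) ≤ 1 / 10 * twoStepGeom (a * M) a q m :=
    mul_le_mul_of_nonneg_right haM (hβ m)
  -- `β m + B (m + 1) ≤ (9 / 10) * B m` is solved by `B m = 2 * β m + 4 * β (m + 1)`
  refine h.norm_succ_sub_le (B := fun m => 2 * twoStepGeom (a * M) a q m +
    4 * twoStepGeom (a * M) a q (m + 1)) hb (fun m => ?_) (fun m => ?_) (by positivity) ?_ hk
  · linarith [hβ m, hβ (m + 1)]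
  · simp only [twoStepGeom]
    nlinarith [hstep m, hβ m, hβ (m + 1)]
  · simp only [twoStepGeom]
    nlinarith [mul_nonneg ha hq, mul_nonneg (sq_nonneg a) (sub_nonneg.2 hM), sq_nonneg a,
      mul_nonneg (sq_nonneg a) (by linarith : 0 ≤ M), mul_le_mul_of_nonneg_right haq hq,
      mul_le_mul_of_nonneg_right haq (mul_nonneg (sq_nonneg a) (by linarith : 0 ≤ M))]

end HeinrichRecursion

section BlockProducts

/-- The sigma-algebra generated by `X s, …, X t`. -/
abbrev blockSigma {Ω : Type*} (X : ℕ → Ω → ℕ) (s t : ℕ) : MeasurableSpace Ω :=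
  ⨆ i ∈ Set.Icc s t, MeasurableSpace.comap (X i) ⊤

/-- The product of `G (X i)` over the half-open block `s < i ≤ t`. -/
def blockProd {Ω R : Type*} [CommMonoid R] (X : ℕ → Ω → ℕ) (G : ℕ → R) (s t : ℕ) (ω : Ω) : R :=
  ∏ i ∈ Finset.Ioc s t, G (X i ω)

variable {Ω R 𝕜 : Type*} {X : ℕ → Ω → ℕ}

theorem blockProd_of_le [CommMonoid R] {G : ℕ → R} {s t : ℕ} (h : t ≤ s) (ω : Ω) :
    blockProd X G s t ω = 1 := by
  simp [blockProd, h]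

theorem blockProd_succ [CommMonoid R] (G : ℕ → R) (s : ℕ) (ω : Ω) :
    blockProd X G s (s + 1) ω = G (X (s + 1) ω) := by
  simp [blockProd]

theorem blockProd_mul_blockProd [CommMonoid R] (G : ℕ → R) {s t u : ℕ} (hst : s ≤ t) (htu : t ≤ u)
    (ω : Ω) : blockProd X G s t ω * blockProd X G t u ω = blockProd X G s u ω :=
  Finset.prod_Ioc_consecutive _ hst htu

theorem norm_blockProd [NormedField 𝕜] (G : ℕ → 𝕜) (s t : ℕ) (ω : Ω) :
    ‖blockProd X G s t ω‖ = blockProd X (fun j => ‖G j‖) s t ω :=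
  norm_prod _ _

theorem measurable_blockProd_blockSigma [CommMonoid R] [MeasurableSpace R] [MeasurableMul₂ R]
    (G : ℕ → R) {s t u v : ℕ} (hs : s ≤ u + 1) (ht : v ≤ t) :
    Measurable[blockSigma X s t] (blockProd X G u v) := by
  refine @Finset.measurable_fun_prod _ _ _ _ _ _ (blockSigma X s t) _ _ fun i hi => ?_
  obtain ⟨hui, hiv⟩ := Finset.mem_Ioc.1 hi
  exact ((measurable_from_top (f := G)).comp (comap_measurable (X i))).mono
    (le_iSup₂_of_le i ⟨by omega, by omega⟩ le_rfl) le_rfl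

variable [m0 : MeasurableSpace Ω] {P : Measure Ω} {n : ℕ}

theorem blockSigma_le (hX : ∀ i ∈ Finset.Icc 1 n, Measurable (X i)) {s t : ℕ} (hs : 1 ≤ s)
    (ht : t ≤ n) : blockSigma X s t ≤ m0 :=
  iSup₂_le fun i hi => (hX i (Finset.mem_Icc.2 ⟨hs.trans hi.1, hi.2.trans ht⟩)).comap_le

theorem measurable_blockProd [CommMonoid R] [MeasurableSpace R] [MeasurableMul₂ R]
    (hX : ∀ i ∈ Finset.Icc 1 n, Measurable (X i)) (G : ℕ → R) {s t : ℕ} (ht : t ≤ n) :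
    Measurable (blockProd X G s t) :=
  (measurable_blockProd_blockSigma G (by omega) ht).mono (blockSigma_le hX le_rfl le_rfl) le_rfl

theorem ae_norm_blockProd_le [NormedField 𝕜] {G : ℕ → 𝕜} {M : ℝ}
    (hM : ∀ᵐ ω ∂P, ∀ i ∈ Finset.Icc 1 n, ‖G (X i ω)‖ ≤ M) {s t : ℕ} (ht : t ≤ n) :
    ∀ᵐ ω ∂P, ‖blockProd X G s t ω‖ ≤ M ^ (t - s) := by
  filter_upwards [hM] with ω hω
  rw [blockProd, norm_prod, ← Nat.card_Ioc, ← Finset.prod_const]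
  refine Finset.prod_le_prod (fun i _ => norm_nonneg _) fun i hi => hω i ?_
  simp only [Finset.mem_Ioc, Finset.mem_Icc] at hi ⊢
  omega

theorem memLp_top_blockProd [RCLike 𝕜] (hX : ∀ i ∈ Finset.Icc 1 n, Measurable (X i)) {G : ℕ → 𝕜}
    {M : ℝ} (hM : ∀ᵐ ω ∂P, ∀ i ∈ Finset.Icc 1 n, ‖G (X i ω)‖ ≤ M) {s t : ℕ} (ht : t ≤ n) :
    MemLp (blockProd X G s t) ⊤ P :=
  memLp_top_of_bound (measurable_blockProd hX G ht).aestronglyMeasurable _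
    (ae_norm_blockProd_le hM ht)

theorem integrable_blockProd_mul_blockProd [RCLike 𝕜] [IsFiniteMeasure P]
    (hX : ∀ i ∈ Finset.Icc 1 n, Measurable (X i)) {F G : ℕ → 𝕜} {M N : ℝ}
    (hF : ∀ᵐ ω ∂P, ∀ i ∈ Finset.Icc 1 n, ‖F (X i ω)‖ ≤ N)
    (hG : ∀ᵐ ω ∂P, ∀ i ∈ Finset.Icc 1 n, ‖G (X i ω)‖ ≤ M) {s t u v : ℕ} (ht : t ≤ n) (hv : v ≤ n) :
    Integrable (fun ω => blockProd X F s t ω * blockProd X G u v ω) P :=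
  ((memLp_top_blockProd hX hF ht).integrable le_top).mul_of_top_left (memLp_top_blockProd hX hG hv)

theorem integral_mul_of_indep [RCLike 𝕜] {m₁ m₂ : MeasurableSpace Ω} (h₁ : m₁ ≤ m0) (h₂ : m₂ ≤ m0)
    (hind : Indep m₁ m₂ P) {U V : Ω → 𝕜} (hU : Measurable[m₁] U) (hV : Measurable[m₂] V) :
    ∫ ω, U ω * V ω ∂P = (∫ ω, U ω ∂P) * ∫ ω, V ω ∂P := by
  have hUV : IndepFun U V P := by
    rw [IndepFun_iff_Indep]
    exact indep_of_indep_of_le_left (indep_of_indep_of_le_right hind hV.comap_le) hU.comap_le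
  exact hUV.integral_fun_mul_eq_mul_integral (hU.mono h₁ le_rfl).aestronglyMeasurable
    (hV.mono h₂ le_rfl).aestronglyMeasurable

theorem integral_blockProd_mul_blockProd [RCLike 𝕜] [IsProbabilityMeasure P]
    (hX : ∀ i ∈ Finset.Icc 1 n, Measurable (X i)) (hdep : IsMDependent 1 n X P) (F G : ℕ → 𝕜)
    {s t u v : ℕ} (htu : t < u) (huv : u < v) (hv : v ≤ n) :
    ∫ ω, blockProd X F s t ω * blockProd X G u v ω ∂P =
      (∫ ω, blockProd X F s t ω ∂P) * ∫ ω, blockProd X G u v ω ∂P := by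
  rcases Nat.eq_zero_or_pos t with rfl | ht
  · simp [blockProd_of_le (Nat.zero_le s)]
  · exact integral_mul_of_indep (blockSigma_le hX le_rfl (by omega))
      (blockSigma_le hX (by omega) le_rfl) (hdep t (u + 1) ht (by omega) (by omega))
      (measurable_blockProd_blockSigma F (by omega) le_rfl)
      (measurable_blockProd_blockSigma G le_rfl hv)

variable [IsProbabilityMeasure P]

theorem integral_blockProd_add_two_le (hX : ∀ i ∈ Finset.Icc 1 n, Measurable (X i))
    (hdep : IsMDependent 1 n X P) {g : ℕ → ℝ} (hg : ∀ j, 0 ≤ g j) {M a : ℝ} (hM₀ : 0 ≤ M)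
    (hM : ∀ᵐ ω ∂P, ∀ i ∈ Finset.Icc 1 n, ‖g (X i ω)‖ ≤ M)
    (ha : ∀ i ∈ Finset.Icc 1 n, ∫ ω, g (X i ω) ∂P ≤ a) {s t : ℕ} (hst : s ≤ t) (ht : t + 2 ≤ n) :
    ∫ ω, blockProd X g s (t + 2) ω ∂P ≤ a * M * ∫ ω, blockProd X g s t ω ∂P := by
  have hnonneg (u v : ℕ) (ω : Ω) : 0 ≤ blockProd X g u v ω := Finset.prod_nonneg fun i _ => hg _
  have hdrop : ∀ᵐ ω ∂P, blockProd X g s (t + 2) ω ≤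
      M * (blockProd X g s t ω * blockProd X g (t + 1) (t + 2) ω) := by
    filter_upwards [hM] with ω hω
    have hmiddle : g (X (t + 1) ω) ≤ M :=
      (le_abs_self _).trans (hω _ (Finset.mem_Icc.2 ⟨by omega, by omega⟩))
    rw [← blockProd_mul_blockProd g (t := t + 1) (by omega) (by omega),
      ← blockProd_mul_blockProd g hst (by omega : t ≤ t + 1), blockProd_succ g t]
    linarith [mul_le_mul_of_nonneg_right hmiddle
      (mul_nonneg (hnonneg s t ω) (hnonneg (t + 1) (t + 2) ω))]
  calc ∫ ω, blockProd X g s (t + 2) ω ∂P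
      ≤ ∫ ω, M * (blockProd X g s t ω * blockProd X g (t + 1) (t + 2) ω) ∂P :=
        integral_mono_of_nonneg (.of_forall (hnonneg s _))
          ((integrable_blockProd_mul_blockProd hX hM hM (by omega) ht).const_mul M) hdrop
    _ = M * ((∫ ω, blockProd X g s t ω ∂P) * ∫ ω, g (X (t + 2) ω) ∂P) := by
        rw [integral_const_mul,
          integral_blockProd_mul_blockProd hX hdep g g (by omega) (by omega) ht]
        simp_rw [blockProd_succ]
    _ ≤ M * ((∫ ω, blockProd X g s t ω ∂P) * a) := by
        gcongr
        · exact integral_nonneg (hnonneg s t)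
        · exact ha _ (Finset.mem_Icc.2 ⟨by omega, ht⟩)
    _ = a * M * ∫ ω, blockProd X g s t ω ∂P := by ring

theorem integral_blockProd_le_twoStepGeom (hX : ∀ i ∈ Finset.Icc 1 n, Measurable (X i))
    (hdep : IsMDependent 1 n X P) {g : ℕ → ℝ} (hg : ∀ j, 0 ≤ g j) {M a q : ℝ} (hM₀ : 0 ≤ M)
    (hM : ∀ᵐ ω ∂P, ∀ i ∈ Finset.Icc 1 n, ‖g (X i ω)‖ ≤ M) (ha₀ : 0 ≤ a)
    (ha : ∀ i ∈ Finset.Icc 1 n, ∫ ω, g (X i ω) ∂P ≤ a)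
    (hq : ∀ i, 1 ≤ i → i < n → ∫ ω, g (X i ω) * g (X (i + 1) ω) ∂P ≤ q) (k m : ℕ)
    (hkm : k + m + 1 ≤ n) :
    ∫ ω, blockProd X g k (k + m + 1) ω ∂P ≤ twoStepGeom (a * M) a q m := by
  induction m using Nat.twoStepInduction with
  | zero =>
    simp_rw [add_zero, blockProd_succ]
    exact ha (k + 1) (Finset.mem_Icc.2 ⟨by omega, hkm⟩)
  | one =>
    simp_rw [← blockProd_mul_blockProd g (by omega : k ≤ k + 1) (by omega : k + 1 ≤ k + 1 + 1),
      blockProd_succ]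
    exact hq (k + 1) (by omega) (by omega)
  | more m ih _ =>
    exact (integral_blockProd_add_two_le hX hdep hg hM₀ hM ha (t := k + m + 1) (by omega)
      hkm).trans (mul_le_mul_of_nonneg_left (ih (by omega)) (mul_nonneg ha₀ hM₀))

theorem isHeinrichRecursion_integral_blockProd (hX : ∀ i ∈ Finset.Icc 1 n, Measurable (X i))
    (hdep : IsMDependent 1 n X P) {G : ℕ → ℂ} {M : ℝ}
    (hM : ∀ᵐ ω ∂P, ∀ i ∈ Finset.Icc 1 n, ‖G (X i ω)‖ ≤ M) :
    IsHeinrichRecursion n (fun k => ∫ ω, blockProd X (fun j => 1 + G j) 0 k ω ∂P)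
      (fun k m => ∫ ω, blockProd X (fun j => 1 + G j) 0 k ω * blockProd X G k (k + m + 1) ω ∂P)
      (fun k m => ∫ ω, blockProd X G k (k + m + 1) ω ∂P) := by
  have hM' : ∀ᵐ ω ∂P, ∀ i ∈ Finset.Icc 1 n, ‖1 + G (X i ω)‖ ≤ 1 + M := by
    filter_upwards [hM] with ω hω i hi
    simpa using norm_add_le_of_le (norm_one (α := ℂ)).le (hω i hi)
  have hint {k u v : ℕ} (hk : k ≤ n) (hv : v ≤ n) := integrable_blockProd_mul_blockProd (P := P)
    (s := 0) (u := u) (F := fun j => 1 + G j) hX hM' hM hk hv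
  have hsucc (k : ℕ) (ω : Ω) : blockProd X (fun j => 1 + G j) 0 (k + 1) ω =
      blockProd X (fun j => 1 + G j) 0 k ω * (1 + G (X (k + 1) ω)) := by
    rw [← blockProd_mul_blockProd _ (Nat.zero_le k) (Nat.le_succ k), blockProd_succ]
  refine ⟨fun m _ => by simp [blockProd_of_le], fun k m hkm => ?_, fun k hk => ?_⟩
  · have hsplit (ω : Ω) : blockProd X G k (k + (m + 1) + 1) ω =
        G (X (k + 1) ω) * blockProd X G (k + 1) (k + 1 + m + 1) ω := by
      rw [← blockProd_succ G, blockProd_mul_blockProd G (by omega) (by omega)]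
      congr 1
      omega
    rw [← integral_blockProd_mul_blockProd hX hdep _ G (by omega) (by omega) hkm,
      ← integral_add (hint (by omega) hkm) (hint (by omega) (by omega))]
    simp_rw [hsucc, hsplit]
    exact integral_congr_ae (.of_forall fun ω => by ring)
  · have hone := hint (u := 0) (v := 0) (by omega : k ≤ n) (Nat.zero_le n)
    simp only [blockProd_of_le (le_refl 0), mul_one] at hone
    rw [← integral_add hone (hint (by omega) hk)]
    simp_rw [hsucc, blockProd_succ, mul_add, mul_one]

theorem norm_integral_prod_succ_sub_le (hX : ∀ i ∈ Finset.Icc 1 n, Measurable (X i))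
    (hdep : IsMDependent 1 n X P) {G : ℕ → ℂ} {M a q : ℝ} (hM₂ : 2 ≤ M)
    (hM : ∀ᵐ ω ∂P, ∀ i ∈ Finset.Icc 1 n, ‖G (X i ω)‖ ≤ M) (ha₀ : 0 ≤ a) (hq₀ : 0 ≤ q)
    (ha : ∀ i ∈ Finset.Icc 1 n, ∫ ω, ‖G (X i ω)‖ ∂P ≤ a)
    (hq : ∀ i, 1 ≤ i → i < n → ∫ ω, ‖G (X i ω)‖ * ‖G (X (i + 1) ω)‖ ∂P ≤ q)
    (haM : a * M ≤ 1 / 10) (haq : 2 * a + 4 * q ≤ 1 / 10) {k : ℕ} (hk : k + 1 ≤ n) :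
    ‖(∫ ω, blockProd X (fun j => 1 + G j) 0 (k + 1) ω ∂P) -
        (1 + ∫ ω, G (X (k + 1) ω) ∂P) * ∫ ω, blockProd X (fun j => 1 + G j) 0 k ω ∂P‖ ≤
      (3 * q + 6 * a ^ 2 * M) * ‖∫ ω, blockProd X (fun j => 1 + G j) 0 k ω ∂P‖ := by
  have hmoment (k m : ℕ) (hkm : k + m + 1 ≤ n) :
      ‖∫ ω, blockProd X G k (k + m + 1) ω ∂P‖ ≤ twoStepGeom (a * M) a q m := by
    refine (norm_integral_le_integral_norm _).trans ?_
    simp_rw [norm_blockProd]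
    exact integral_blockProd_le_twoStepGeom hX hdep (fun j => norm_nonneg _) (by linarith)
      (by simpa only [norm_norm] using hM) ha₀ ha hq k m hkm
  have hstep := (isHeinrichRecursion_integral_blockProd hX hdep hM).norm_succ_sub_le_of_twoStepGeom
    hM₂ ha₀ hq₀ haM haq hmoment hk
  simpa only [add_zero, blockProd_succ] using hstep

end BlockProducts

section StepErrors

theorem norm_sub_pow_le_of_step {R : Type*} [NormedRing R] [NormOneClass R] {f : ℕ → R} {w : R}
    {κ : ℝ} {n : ℕ} (hκ : 0 ≤ κ) (h₀ : f 0 = 1)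
    (h : ∀ k < n, ‖f (k + 1) - w * f k‖ ≤ κ * ‖w‖ * ‖f k‖) :
    ‖f n - w ^ n‖ ≤ ((1 + κ) ^ n - 1) * ‖w‖ ^ n := by
  have hgrowth : ∀ k ≤ n, ‖f k‖ ≤ (1 + κ) ^ k * ‖w‖ ^ k := by
    intro k hk
    induction k with
    | zero => simp [h₀]
    | succ k ih =>
      calc ‖f (k + 1)‖ ≤ ‖f (k + 1) - w * f k‖ + ‖w * f k‖ := norm_le_norm_sub_add _ _
        _ ≤ κ * ‖w‖ * ‖f k‖ + ‖w‖ * ‖f k‖ := add_le_add (h k hk) (norm_mul_le _ _)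
        _ = (1 + κ) * ‖w‖ * ‖f k‖ := by ring
        _ ≤ (1 + κ) * ‖w‖ * ((1 + κ) ^ k * ‖w‖ ^ k) := by gcongr; exact ih (by omega)
        _ = (1 + κ) ^ (k + 1) * ‖w‖ ^ (k + 1) := by ring
  suffices hsuff : ∀ k ≤ n, ‖f k - w ^ k‖ ≤ ((1 + κ) ^ k - 1) * ‖w‖ ^ k from hsuff n le_rfl
  intro k hk
  induction k with
  | zero => simp [h₀]
  | succ k ih =>
    calc ‖f (k + 1) - w ^ (k + 1)‖ = ‖(f (k + 1) - w * f k) + w * (f k - w ^ k)‖ := by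
          rw [mul_sub, ← pow_succ', sub_add_sub_cancel]
      _ ≤ κ * ‖w‖ * ‖f k‖ + ‖w‖ * ‖f k - w ^ k‖ :=
          norm_add_le_of_le (h k hk) (norm_mul_le _ _)
      _ ≤ κ * ‖w‖ * ((1 + κ) ^ k * ‖w‖ ^ k) + ‖w‖ * (((1 + κ) ^ k - 1) * ‖w‖ ^ k) := by
          gcongr
          · exact hgrowth k (by omega)
          · exact ih (by omega)
      _ = ((1 + κ) ^ (k + 1) - 1) * ‖w‖ ^ (k + 1) := by ring

theorem sub_one_le_mul_of_le_exp {a g : ℝ} (hg : 0 < g) (h : g ≤ Real.exp a) : g - 1 ≤ a * g := by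
  have hlog : 1 - g⁻¹ ≤ a :=
    (Real.one_sub_inv_le_log_of_pos hg).trans ((Real.log_le_iff_le_exp hg).2 h)
  calc g - 1 = (1 - g⁻¹) * g := by rw [sub_mul, one_mul, inv_mul_cancel₀ hg.ne']
    _ ≤ a * g := by gcongr

theorem norm_sub_exp_le_of_step {f : ℕ → ℂ} {v : ℂ} {κ : ℝ} {n : ℕ} (hκ : 0 ≤ κ) (h₀ : f 0 = 1)
    (h : ∀ k < n, ‖f (k + 1) - Complex.exp v * f k‖ ≤ κ * ‖Complex.exp v‖ * ‖f k‖) :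
    ‖f n - Complex.exp (n * v)‖ ≤ n * κ * Real.exp (n * v.re + n * κ) := by
  have hgrowth : (1 + κ) ^ n ≤ Real.exp (n * κ) := by
    rw [Real.exp_nat_mul]
    gcongr
    linarith [Real.add_one_le_exp κ]
  calc ‖f n - Complex.exp (n * v)‖ ≤ ((1 + κ) ^ n - 1) * ‖Complex.exp v‖ ^ n := by
        rw [Complex.exp_nat_mul]
        exact norm_sub_pow_le_of_step hκ h₀ h
    _ ≤ n * κ * Real.exp (n * κ) * Real.exp v.re ^ n := by
        rw [Complex.norm_exp]
        gcongr
        exact (sub_le_sub_right hgrowth 1).trans (sub_one_le_mul_of_le_exp (Real.exp_pos _) le_rfl)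
    _ = n * κ * Real.exp (n * v.re + n * κ) := by
        rw [← Real.exp_nat_mul, mul_assoc, ← Real.exp_add, add_comm]

theorem norm_one_add_sub_exp_le {v e : ℂ} (hv : ‖v‖ ≤ 1) :
    ‖1 + e - Complex.exp v‖ ≤ ‖e - v‖ + ‖v‖ ^ 2 := by
  rw [show 1 + e - Complex.exp v = (e - v) - (Complex.exp v - 1 - v) by ring]
  exact norm_sub_le_of_le le_rfl (Complex.norm_exp_sub_one_sub_id_le hv)

end StepErrors

section PowerEstimates

variable {R : Type*} [NormedRing R] [NormOneClass R] {z : R} {r : ℝ}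

theorem norm_pow_sub_one_le (hz : ‖z‖ ≤ r) (hr : 1 ≤ r) (k : ℕ) :
    ‖z ^ k - 1‖ ≤ k * r ^ k * ‖z - 1‖ := by
  induction k with
  | zero => simp
  | succ k ih =>
    calc ‖z ^ (k + 1) - 1‖ = ‖z ^ k * (z - 1) + (z ^ k - 1)‖ := by congr 1; noncomm_ring
      _ ≤ r ^ k * ‖z - 1‖ + k * r ^ k * ‖z - 1‖ := by
          refine norm_add_le_of_le ((norm_mul_le _ _).trans ?_) ih
          gcongr
          exact (norm_pow_le z k).trans (by gcongr)
      _ = (k + 1 : ℕ) * r ^ k * ‖z - 1‖ := by push_cast; ring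
      _ ≤ (k + 1 : ℕ) * r ^ (k + 1) * ‖z - 1‖ := by gcongr; omega

theorem norm_pow_sub_one_sub_le (hz : ‖z‖ ≤ r) (hr : 1 ≤ r) (k : ℕ) :
    ‖z ^ k - 1 - k * (z - 1)‖ ≤ k * (k - 1) * r ^ k * ‖z - 1‖ ^ 2 := by
  induction k with
  | zero => simp
  | succ k ih =>
    calc ‖z ^ (k + 1) - 1 - (k + 1 : ℕ) * (z - 1)‖
        = ‖(z ^ k - 1 - k * (z - 1)) + (z ^ k - 1) * (z - 1)‖ := by
          congr 1; push_cast; noncomm_ring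
      _ ≤ k * (k - 1) * r ^ k * ‖z - 1‖ ^ 2 + k * r ^ k * ‖z - 1‖ * ‖z - 1‖ := by
          refine norm_add_le_of_le ih ((norm_mul_le _ _).trans ?_)
          gcongr
          exact norm_pow_sub_one_le hz hr k
      _ = k * k * r ^ k * ‖z - 1‖ ^ 2 := by ring
      _ ≤ (k + 1 : ℕ) * k * r ^ (k + 1) * ‖z - 1‖ ^ 2 := by gcongr <;> omega
      _ = (k + 1 : ℕ) * ((k + 1 : ℕ) - 1) * r ^ (k + 1) * ‖z - 1‖ ^ 2 := by push_cast; ring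

end PowerEstimates

section MomentEstimates

variable {Ω : Type*} [MeasurableSpace Ω] {P : Measure Ω} {U V : Ω → ℕ}
  {L r : ℝ} {z : ℂ}

theorem memLp_top_natCast_of_ae_pow_le (hU : Measurable U) (hr : 1 < r)
    (hL : ∀ᵐ ω ∂P, r ^ U ω ≤ L) : MemLp (fun ω => (U ω : ℝ)) ⊤ P := by
  refine memLp_top_of_bound (by fun_prop) (L / (r - 1)) ?_
  filter_upwards [hL] with ω hω
  rw [Real.norm_of_nonneg (by positivity), le_div_iff₀ (by linarith)]
  linarith [one_add_mul_sub_le_pow (by linarith : -1 ≤ r) (U ω)]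

theorem natCast_mul_sub_one_nonneg (k : ℕ) : (0 : ℝ) ≤ k * (k - 1) := by
  rcases k with _ | k
  · simp
  · push_cast
    rw [add_sub_cancel_right]
    positivity

theorem ae_norm_pow_sub_one_le (hz : ‖z‖ ≤ r) (hr : 1 ≤ r) (hL : ∀ᵐ ω ∂P, r ^ U ω ≤ L) :
    ∀ᵐ ω ∂P, ‖z ^ U ω - 1‖ ≤ ‖z - 1‖ * L * U ω := by
  filter_upwards [hL] with ω hω
  calc ‖z ^ U ω - 1‖ ≤ U ω * r ^ U ω * ‖z - 1‖ := norm_pow_sub_one_le hz hr _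
    _ ≤ U ω * L * ‖z - 1‖ := by gcongr
    _ = ‖z - 1‖ * L * U ω := by ring

variable [IsFiniteMeasure P]

theorem integrable_natCast_mul_of_ae_pow_le (hU : Measurable U) (hV : Measurable V) (hr : 1 < r)
    (hUL : ∀ᵐ ω ∂P, r ^ U ω ≤ L) (hVL : ∀ᵐ ω ∂P, r ^ V ω ≤ L) :
    Integrable (fun ω => (U ω : ℝ) * V ω) P :=
  ((memLp_top_natCast_of_ae_pow_le hU hr hUL).integrable le_top).mul_of_top_left
    (memLp_top_natCast_of_ae_pow_le hV hr hVL)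

theorem integral_norm_pow_sub_one_le (hU : Measurable U) (hz : ‖z‖ ≤ r) (hr : 1 < r)
    (hL : ∀ᵐ ω ∂P, r ^ U ω ≤ L) :
    ∫ ω, ‖z ^ U ω - 1‖ ∂P ≤ ‖z - 1‖ * L * ∫ ω, (U ω : ℝ) ∂P := by
  rw [← integral_const_mul]
  exact integral_mono_of_nonneg (.of_forall fun ω => norm_nonneg _)
    (((memLp_top_natCast_of_ae_pow_le hU hr hL).integrable le_top).const_mul _)
    (ae_norm_pow_sub_one_le hz hr.le hL)

theorem integral_norm_pow_sub_one_mul_le (hU : Measurable U) (hV : Measurable V) (hz : ‖z‖ ≤ r)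
    (hr : 1 < r) (hUL : ∀ᵐ ω ∂P, r ^ U ω ≤ L) (hVL : ∀ᵐ ω ∂P, r ^ V ω ≤ L) :
    ∫ ω, ‖z ^ U ω - 1‖ * ‖z ^ V ω - 1‖ ∂P ≤
      (‖z - 1‖ * L) ^ 2 * ∫ ω, (U ω : ℝ) * V ω ∂P := by
  rw [← integral_const_mul]
  refine integral_mono_of_nonneg (.of_forall fun ω => by positivity)
    ((integrable_natCast_mul_of_ae_pow_le hU hV hr hUL hVL).const_mul _) ?_
  filter_upwards [ae_norm_pow_sub_one_le hz hr.le hUL, ae_norm_pow_sub_one_le hz hr.le hVL]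
    with ω hUω hVω
  calc ‖z ^ U ω - 1‖ * ‖z ^ V ω - 1‖ ≤ ‖z - 1‖ * L * U ω * (‖z - 1‖ * L * V ω) :=
        mul_le_mul hUω hVω (norm_nonneg _) ((norm_nonneg _).trans hUω)
    _ = (‖z - 1‖ * L) ^ 2 * (U ω * V ω) := by ring

theorem norm_integral_pow_sub_one_sub_le (hU : Measurable U) (hz : ‖z‖ ≤ r) (hr : 1 < r)
    (hL : ∀ᵐ ω ∂P, r ^ U ω ≤ L) :
    ‖∫ ω, (z ^ U ω - 1) ∂P - (∫ ω, (U ω : ℝ) ∂P) * (z - 1)‖ ≤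
      L * ‖z - 1‖ ^ 2 * ∫ ω, (U ω : ℝ) * (U ω - 1) ∂P := by
  have hU₁ : Integrable (fun ω => (U ω : ℝ)) P :=
    (memLp_top_natCast_of_ae_pow_le hU hr hL).integrable le_top
  have hU₂ : Integrable (fun ω => (U ω : ℝ) * (U ω - 1)) P := by
    simp_rw [mul_sub, mul_one]
    exact (integrable_natCast_mul_of_ae_pow_le hU hU hr hL hL).sub hU₁
  have hpow : Integrable (fun ω => z ^ U ω - 1) P :=
    (hU₁.const_mul (‖z - 1‖ * L)).mono' (by fun_prop) (ae_norm_pow_sub_one_le hz hr.le hL)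
  have hlin : Integrable (fun ω => ((U ω : ℝ) : ℂ) * (z - 1)) P := hU₁.ofReal.mul_const _
  rw [← integral_complex_ofReal, ← integral_mul_const,
    ← integral_sub hpow hlin, ← integral_const_mul]
  refine norm_integral_le_of_norm_le (hU₂.const_mul _) ?_
  filter_upwards [hL] with ω hω
  rw [Complex.ofReal_natCast]
  calc ‖z ^ U ω - 1 - U ω * (z - 1)‖ ≤ U ω * (U ω - 1) * r ^ U ω * ‖z - 1‖ ^ 2 :=
        norm_pow_sub_one_sub_le hz hr.le _
    _ ≤ U ω * (U ω - 1) * L * ‖z - 1‖ ^ 2 := by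
        gcongr
        exact natCast_mul_sub_one_nonneg _
    _ = L * ‖z - 1‖ ^ 2 * (U ω * (U ω - 1)) := by ring

end MomentEstimates

section PoissonApproximation

variable {Ω : Type*} [MeasurableSpace Ω] {P : Measure Ω} {X : ℕ → Ω → ℕ}
  {n : ℕ} {L ν₁ ν₂ ν₁₂ : ℝ} {z : ℂ}

theorem norm_sub_one_le_of_norm_le (hz : ‖z‖ ≤ 11 / 10) : ‖z - 1‖ ≤ 21 / 10 :=
  (norm_sub_le z 1).trans (by rw [norm_one]; linarith)

theorem ae_forall_norm_pow_sub_one_le (hL₁ : 1 ≤ L)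
    (hL : ∀ i ∈ Finset.Icc 1 n, ∀ᵐ ω ∂P, (11 / 10 : ℝ) ^ X i ω ≤ L) (hz : ‖z‖ ≤ 11 / 10) :
    ∀ᵐ ω ∂P, ∀ i ∈ Finset.Icc 1 n, ‖z ^ X i ω - 1‖ ≤ 2 * L := by
  filter_upwards [(Finset.eventually_all _).2 hL] with ω hω i hi
  calc ‖z ^ X i ω - 1‖ ≤ ‖z‖ ^ X i ω + 1 := by simpa using norm_sub_le (z ^ X i ω) 1
    _ ≤ (11 / 10) ^ X i ω + 1 := by gcongr
    _ ≤ 2 * L := by linarith [hω i hi]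

variable [IsProbabilityMeasure P]

theorem norm_integral_prod_pow_succ_sub_le (hX : ∀ i ∈ Finset.Icc 1 n, Measurable (X i))
    (hdep : IsMDependent 1 n X P) (hL₁ : 1 ≤ L)
    (hL : ∀ i ∈ Finset.Icc 1 n, ∀ᵐ ω ∂P, (11 / 10 : ℝ) ^ X i ω ≤ L)
    (hν₁₀ : 0 ≤ ν₁) (hν₁ : ∀ i ∈ Finset.Icc 1 n, ∫ ω, (X i ω : ℝ) ∂P = ν₁) (hν₁₂₀ : 0 ≤ ν₁₂)
    (hν₁₂ : ∀ i, 1 ≤ i → i < n → ∫ ω, (X i ω : ℝ) * X (i + 1) ω ∂P ≤ ν₁₂)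
    (hLν₁ : L ^ 2 * ν₁ ≤ 2 / 1000) (hLν₁₂ : L ^ 2 * ν₁₂ ≤ ν₁ / 40) (hz : ‖z‖ ≤ 11 / 10) {k : ℕ}
    (hk : k < n) :
    ‖(∫ ω, blockProd X (fun j => z ^ j) 0 (k + 1) ω ∂P) -
        (1 + ∫ ω, (z ^ X (k + 1) ω - 1) ∂P) * ∫ ω, blockProd X (fun j => z ^ j) 0 k ω ∂P‖ ≤
      (3 * (L ^ 2 * ν₁₂) + 12 * (L ^ 3 * ν₁ ^ 2)) * ‖z - 1‖ ^ 2 *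
        ‖∫ ω, blockProd X (fun j => z ^ j) 0 k ω ∂P‖ := by
  have hd : ‖z - 1‖ ≤ 21 / 10 := norm_sub_one_le_of_norm_le hz
  have hd₂ : ‖z - 1‖ ^ 2 ≤ 441 / 100 := by nlinarith [norm_nonneg (z - 1)]
  have ha₀ : 0 ≤ ‖z - 1‖ * L * ν₁ := by positivity
  have hν₁s : ν₁ ≤ 2 / 1000 := (le_mul_of_one_le_left hν₁₀ (one_le_pow₀ hL₁)).trans hLν₁
  have hLν₁' : L * ν₁ ≤ 2 / 1000 := by nlinarith [mul_nonneg hν₁₀ (by linarith : 0 ≤ L)]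
  have ha : ‖z - 1‖ * L * ν₁ ≤ 1 / 200 := by nlinarith [mul_nonneg (by linarith : 0 ≤ L) hν₁₀]
  have haM : ‖z - 1‖ * L * ν₁ * (2 * L) ≤ 1 / 10 := by
    nlinarith [mul_nonneg (sq_nonneg L) hν₁₀]
  have hq : (‖z - 1‖ * L) ^ 2 * ν₁₂ ≤ 1 / 200 := by
    nlinarith [mul_nonneg (sq_nonneg L) hν₁₂₀]
  have hstep := norm_integral_prod_succ_sub_le (G := fun j => z ^ j - 1) hX hdep (by linarith)
    (ae_forall_norm_pow_sub_one_le hL₁ hL hz) ha₀ (q := (‖z - 1‖ * L) ^ 2 * ν₁₂) (by positivity)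
    (fun i hi => ?_) (fun i hi hin => ?_) haM (by linarith) hk
  · simp only [add_sub_cancel] at hstep
    exact hstep.trans_eq (by ring)
  · rw [← hν₁ i hi]
    exact integral_norm_pow_sub_one_le (hX i hi) hz (by norm_num) (hL i hi)
  · have hi₁ : i ∈ Finset.Icc 1 n := Finset.mem_Icc.2 ⟨hi, hin.le⟩
    have hi₂ : i + 1 ∈ Finset.Icc 1 n := Finset.mem_Icc.2 ⟨by omega, hin⟩
    exact (integral_norm_pow_sub_one_mul_le (hX i hi₁) (hX _ hi₂) hz (by norm_num) (hL i hi₁)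
      (hL _ hi₂)).trans (by gcongr; exact hν₁₂ i hi hin)

theorem norm_one_add_integral_pow_sub_exp_le {U : Ω → ℕ} (hU : Measurable U) (hL₁ : 1 ≤ L)
    (hL : ∀ᵐ ω ∂P, (11 / 10 : ℝ) ^ U ω ≤ L) (hν₁ : ∫ ω, (U ω : ℝ) ∂P = ν₁)
    (hν₁s : ν₁ ≤ 2 / 1000) (hν₂ : ∫ ω, (U ω : ℝ) * (U ω - 1) ∂P ≤ ν₂) (hz : ‖z‖ ≤ 11 / 10) :
    ‖1 + ∫ ω, (z ^ U ω - 1) ∂P - Complex.exp (ν₁ * (z - 1))‖ ≤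
      (L * ν₂ + ν₁ ^ 2) * ‖z - 1‖ ^ 2 := by
  have hν₁₀ : 0 ≤ ν₁ := hν₁ ▸ integral_nonneg fun ω => Nat.cast_nonneg _
  have hd : ‖z - 1‖ ≤ 21 / 10 := norm_sub_one_le_of_norm_le hz
  have hnorm : ‖(ν₁ : ℂ) * (z - 1)‖ = ν₁ * ‖z - 1‖ := by
    rw [norm_mul, Complex.norm_real, Real.norm_of_nonneg hν₁₀]
  have hmean := norm_integral_pow_sub_one_sub_le hU hz (by norm_num) hL
  rw [hν₁] at hmean
  refine (norm_one_add_sub_exp_le (hnorm.trans_le (by nlinarith))).trans ?_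
  rw [hnorm]
  have hsecond : L * ‖z - 1‖ ^ 2 * ∫ ω, (U ω : ℝ) * (U ω - 1) ∂P ≤ L * ‖z - 1‖ ^ 2 * ν₂ := by
    gcongr
  linarith

theorem norm_integral_prod_pow_succ_sub_exp_mul_le (hX : ∀ i ∈ Finset.Icc 1 n, Measurable (X i))
    (hdep : IsMDependent 1 n X P) (hL₁ : 1 ≤ L)
    (hL : ∀ i ∈ Finset.Icc 1 n, ∀ᵐ ω ∂P, (11 / 10 : ℝ) ^ X i ω ≤ L)
    (hν₁₀ : 0 ≤ ν₁) (hν₁ : ∀ i ∈ Finset.Icc 1 n, ∫ ω, (X i ω : ℝ) ∂P = ν₁)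
    (hν₂ : ∀ i ∈ Finset.Icc 1 n, ∫ ω, (X i ω : ℝ) * (X i ω - 1) ∂P ≤ ν₂) (hν₁₂₀ : 0 ≤ ν₁₂)
    (hν₁₂ : ∀ i, 1 ≤ i → i < n → ∫ ω, (X i ω : ℝ) * X (i + 1) ω ∂P ≤ ν₁₂)
    (hLν₁ : L ^ 2 * ν₁ ≤ 2 / 1000) (hLν₁₂ : L ^ 2 * ν₁₂ ≤ ν₁ / 40) (hz : ‖z‖ ≤ 11 / 10) {k : ℕ}
    (hk : k < n) :
    ‖(∫ ω, blockProd X (fun j => z ^ j) 0 (k + 1) ω ∂P) -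
        Complex.exp (ν₁ * (z - 1)) * ∫ ω, blockProd X (fun j => z ^ j) 0 k ω ∂P‖ ≤
      (L * ν₂ + 3 * (L ^ 2 * ν₁₂) + 13 * (L ^ 3 * ν₁ ^ 2)) * ‖z - 1‖ ^ 2 *
        ‖∫ ω, blockProd X (fun j => z ^ j) 0 k ω ∂P‖ := by
  have hmem : k + 1 ∈ Finset.Icc 1 n := Finset.mem_Icc.2 ⟨by omega, hk⟩
  have hν₁s : ν₁ ≤ 2 / 1000 := (le_mul_of_one_le_left hν₁₀ (one_le_pow₀ hL₁)).trans hLν₁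
  have hproduct := norm_integral_prod_pow_succ_sub_le hX hdep hL₁ hL hν₁₀ hν₁ hν₁₂₀ hν₁₂ hLν₁
    hLν₁₂ hz hk
  have hfactor := norm_one_add_integral_pow_sub_exp_le (hX _ hmem) hL₁ (hL _ hmem) (hν₁ _ hmem)
    hν₁s (hν₂ _ hmem) hz
  have hsq : ν₁ ^ 2 ≤ L ^ 3 * ν₁ ^ 2 := le_mul_of_one_le_left (sq_nonneg _) (one_le_pow₀ hL₁)
  set f := ∫ ω, blockProd X (fun j => z ^ j) 0 k ω ∂P
  calc _ ≤ (3 * (L ^ 2 * ν₁₂) + 12 * (L ^ 3 * ν₁ ^ 2)) * ‖z - 1‖ ^ 2 * ‖f‖ +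
        (L * ν₂ + ν₁ ^ 2) * ‖z - 1‖ ^ 2 * ‖f‖ := by
        refine (norm_sub_le_norm_sub_add_norm_sub _
          ((1 + ∫ ω, (z ^ X (k + 1) ω - 1) ∂P) * f) _).trans (add_le_add hproduct ?_)
        rw [← sub_mul, norm_mul]
        gcongr
    _ = (L * ν₂ + 3 * (L ^ 2 * ν₁₂) + 12 * (L ^ 3 * ν₁ ^ 2) + ν₁ ^ 2) * ‖z - 1‖ ^ 2 * ‖f‖ := by
        ring
    _ ≤ (L * ν₂ + 3 * (L ^ 2 * ν₁₂) + 13 * (L ^ 3 * ν₁ ^ 2)) * ‖z - 1‖ ^ 2 * ‖f‖ := by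
        refine mul_le_mul_of_nonneg_right (mul_le_mul_of_nonneg_right ?_ (sq_nonneg _))
          (norm_nonneg _)
        linarith

theorem norm_pgf_sum_sub_exp_le (hX : ∀ i ∈ Finset.Icc 1 n, Measurable (X i))
    (hdep : IsMDependent 1 n X P) (hL₁ : 1 ≤ L)
    (hL : ∀ i ∈ Finset.Icc 1 n, ∀ᵐ ω ∂P, (11 / 10 : ℝ) ^ X i ω ≤ L)
    (hν₁₀ : 0 ≤ ν₁) (hν₁ : ∀ i ∈ Finset.Icc 1 n, ∫ ω, (X i ω : ℝ) ∂P = ν₁) (hν₂₀ : 0 ≤ ν₂)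
    (hν₂ : ∀ i ∈ Finset.Icc 1 n, ∫ ω, (X i ω : ℝ) * (X i ω - 1) ∂P ≤ ν₂) (hν₁₂₀ : 0 ≤ ν₁₂)
    (hν₁₂ : ∀ i, 1 ≤ i → i < n → ∫ ω, (X i ω : ℝ) * X (i + 1) ω ∂P ≤ ν₁₂)
    (hLν₁ : L ^ 2 * ν₁ ≤ 2 / 1000) (hLν₁₂ : L ^ 2 * ν₁₂ ≤ ν₁ / 40) {δ : ℝ}
    (hδ : 11 / 10 * n * (L * ν₂ + 3 * (L ^ 2 * ν₁₂) + 13 * (L ^ 3 * ν₁ ^ 2)) ≤ δ)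
    (hz : ‖z‖ ≤ 11 / 10) :
    ‖pgf (P.map fun ω => ∑ i ∈ Finset.Icc 1 n, X i ω) z - Complex.exp (n * ν₁ * (z - 1))‖ ≤
      δ * ‖z - 1‖ ^ 2 * Real.exp (n * ν₁ * (z - 1).re + δ * ‖z - 1‖ ^ 2) := by
  set ε := L * ν₂ + 3 * (L ^ 2 * ν₁₂) + 13 * (L ^ 3 * ν₁ ^ 2)
  set w := Complex.exp (ν₁ * (z - 1)) with hw
  have hε₀ : 0 ≤ ε := by positivity
  have hν₁s : ν₁ ≤ 2 / 1000 := (le_mul_of_one_le_left hν₁₀ (one_le_pow₀ hL₁)).trans hLν₁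
  have hw_norm : 10 / 11 ≤ ‖w‖ := by
    have hre := (abs_le.1 (Complex.abs_re_le_norm (z - 1))).1
    have hd := norm_sub_one_le_of_norm_le hz
    rw [hw, Complex.norm_exp, Complex.re_ofReal_mul]
    nlinarith [Real.add_one_le_exp (ν₁ * (z - 1).re)]
  have hstep (k : ℕ) (hk : k < n) :=
    (norm_integral_prod_pow_succ_sub_exp_mul_le hX hdep hL₁ hL hν₁₀ hν₁ hν₂ hν₁₂₀ hν₁₂ hLν₁ hLν₁₂ hz
      hk).trans (mul_le_mul_of_nonneg_right (b := ε * ‖z - 1‖ ^ 2)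
        (c := 11 / 10 * ε * ‖z - 1‖ ^ 2 * ‖w‖)
        (by nlinarith [mul_nonneg hε₀ (sq_nonneg ‖z - 1‖)]) (norm_nonneg _))
  have hmain := norm_sub_exp_le_of_step
    (f := fun k => ∫ ω, blockProd X (fun j => z ^ j) 0 k ω ∂P) (by positivity)
    (by simp [blockProd_of_le]) hstep
  have hsum : pgf (P.map fun ω => ∑ i ∈ Finset.Icc 1 n, X i ω) z =
      ∫ ω, blockProd X (fun j => z ^ j) 0 n ω ∂P := by
    rw [pgf_map (Finset.measurable_fun_sum _ hX).aemeasurable]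
    exact integral_congr_ae (.of_forall fun ω => (Finset.prod_pow_eq_pow_sum _ _ z).symm)
  have hδ' : n * (11 / 10 * ε * ‖z - 1‖ ^ 2) ≤ δ * ‖z - 1‖ ^ 2 := by
    rw [← mul_assoc, ← mul_assoc, mul_comm (n : ℝ)]
    gcongr
  rw [hsum, mul_assoc]
  refine hmain.trans (mul_le_mul hδ' (Real.exp_le_exp.2 ?_) (Real.exp_nonneg _)
    (le_trans (by positivity) hδ'))
  rw [Complex.re_ofReal_mul, ← mul_assoc]
  gcongr

end PoissonApproximation

section PoissonLowerBound

open scoped Real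

theorem factorial_le_stirling {x : ℕ} (hx : x ≠ 0) :
    (x.factorial : ℝ) ≤ Real.exp 1 * √x * (x / Real.exp 1) ^ x := by
  obtain ⟨k, rfl⟩ := Nat.exists_eq_succ_of_ne_zero hx
  have h : Stirling.stirlingSeq (k + 1) ≤ Stirling.stirlingSeq 1 :=
    Stirling.stirlingSeq'_antitone (Nat.zero_le k)
  rw [Stirling.stirlingSeq_one, Stirling.stirlingSeq, div_le_iff₀ (by positivity)] at h
  refine h.trans_eq ?_
  rw [Real.sqrt_mul zero_le_two]
  field_simp

theorem factorial_le_pi_mul_sqrt_mul {x : ℕ} {l : ℝ} (hx : x ≠ 0) (hxl : x ≤ 11 / 10 * l) :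
    (x.factorial : ℝ) ≤ π * √l * (x / Real.exp 1) ^ x := by
  have hsqrt : √(x : ℝ) ≤ 11 / 10 * √l := by
    calc √(x : ℝ) ≤ √((11 / 10) ^ 2 * l) := Real.sqrt_le_sqrt (by linarith [x.cast_nonneg (α := ℝ)])
      _ = 11 / 10 * √l := by rw [Real.sqrt_mul (by positivity), Real.sqrt_sq (by norm_num)]
  refine (factorial_le_stirling hx).trans (mul_le_mul_of_nonneg_right ?_ (by positivity))
  calc Real.exp 1 * √(x : ℝ) ≤ 2.7182818286 * (11 / 10 * √l) := by
        gcongr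
        exact Real.exp_one_lt_d9.le
    _ ≤ π * √l := by nlinarith [Real.pi_gt_d2, Real.sqrt_nonneg l]

theorem two_mul_exp_div_sqrt_le_poissonMeasure {l r : ℝ} {x : ℕ} (hl : 0 < l) (hr₀ : 0 < r)
    (hr : r ≤ 11 / 10) (hx : (x : ℝ) = l * r) :
    2 * Real.exp (l * (r - 1)) / √l ≤ 2 * π * r ^ x * (poissonMeasure l.toNNReal).real {x} := by
  have hx₀ : x ≠ 0 := Nat.cast_ne_zero.1 (hx.trans_ne (by positivity) : (x : ℝ) ≠ 0)
  have hfactorial := factorial_le_pi_mul_sqrt_mul (l := l) hx₀ (by rw [hx]; nlinarith)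
  have hexp : Real.exp (l * (r - 1)) * (x / Real.exp 1) ^ x = Real.exp (-l) * (x : ℝ) ^ x := by
    rw [mul_sub, mul_one, ← hx, sub_eq_neg_add, Real.exp_add, div_pow, ← Real.exp_nat_mul, mul_one]
    field_simp
  rw [poissonMeasure_real_singleton, Real.coe_toNNReal _ hl.le, mul_div_assoc',
    div_le_div_iff₀ (by positivity) (by positivity)]
  calc 2 * Real.exp (l * (r - 1)) * x.factorial
      ≤ 2 * Real.exp (l * (r - 1)) * (π * √l * (x / Real.exp 1) ^ x) := by gcongr
    _ = 2 * π * (Real.exp (l * (r - 1)) * (x / Real.exp 1) ^ x) * √l := by ring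
    _ = 2 * π * r ^ x * (Real.exp (-l) * l ^ x) * √l := by rw [hexp, hx, mul_pow]; ring

end PoissonLowerBound

section GaussianTransfer

open scoped Real

theorem norm_circleMap_sub_one_sq (r t : ℝ) :
    ‖circleMap 0 r t - 1‖ ^ 2 = (r - 1) ^ 2 + 2 * r * (1 - Real.cos t) := by
  rw [circleMap_zero, ← Complex.normSq_eq_norm_sq, Complex.normSq_apply, Complex.sub_re,
    Complex.sub_im, Complex.re_ofReal_mul, Complex.im_ofReal_mul, Complex.exp_ofReal_mul_I_re,
    Complex.exp_ofReal_mul_I_im, Complex.one_re, Complex.one_im]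
  linear_combination r ^ 2 * Real.sin_sq_add_cos_sq t

theorem re_circleMap_sub_one (r t : ℝ) :
    (circleMap 0 r t - 1).re = (r - 1) - r * (1 - Real.cos t) := by
  rw [circleMap_zero, Complex.sub_re, Complex.re_ofReal_mul, Complex.exp_ofReal_mul_I_re,
    Complex.one_re]
  ring

theorem sq_div_five_le_one_sub_cos {t : ℝ} (ht : |t| ≤ π) : t ^ 2 / 5 ≤ 1 - Real.cos t := by
  have hpi : π ^ 2 ≤ 10 := by nlinarith [Real.pi_lt_d2, Real.pi_pos]
  calc t ^ 2 / 5 = 2 / 10 * t ^ 2 := by ring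
    _ ≤ 2 / π ^ 2 * t ^ 2 := by gcongr
    _ ≤ 1 - Real.cos t := by linarith [Real.cos_le_one_sub_mul_cos_sq ht]

theorem add_mul_mul_exp_neg_le {A c κ u : ℝ} (hA : 0 ≤ A) (hc : 0 ≤ c) (hκ : 0 < κ) (hu : 0 ≤ u) :
    (A + c * u) * Real.exp (-(κ * u)) ≤ A + c / κ := by
  have hexp : Real.exp (-(κ * u)) ≤ 1 := Real.exp_le_one_iff.2 (neg_nonpos.2 (by positivity))
  have hlin : κ * u * Real.exp (-(κ * u)) ≤ 1 :=
    (Real.mul_exp_neg_le_exp_neg_one _).trans (Real.exp_le_one_iff.2 (by norm_num))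
  calc (A + c * u) * Real.exp (-(κ * u))
      = A * Real.exp (-(κ * u)) + c / κ * (κ * u * Real.exp (-(κ * u))) := by
        field_simp
    _ ≤ A * 1 + c / κ * 1 := by gcongr
    _ = A + c / κ := by ring

variable {l δ r : ℝ}

theorem mul_exp_circleMap_le_gaussian {t : ℝ} (hl : 0 < l) (hδ₀ : 0 ≤ δ) (hδ : δ ≤ 165 / 1000 * l)
    (hr : |r - 1| ≤ 1 / 10) (ht : |t| ≤ π) :
    δ * ‖circleMap 0 r t - 1‖ ^ 2 *
        Real.exp (l * (circleMap 0 r t - 1).re + δ * ‖circleMap 0 r t - 1‖ ^ 2) ≤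
      δ * ((r - 1) ^ 2 + 8 / l) * Real.exp (l * (r - 1) + δ * (r - 1) ^ 2) *
        Real.exp (-(6 / 100 * l) * t ^ 2) := by
  rw [norm_circleMap_sub_one_sq, re_circleMap_sub_one]
  obtain ⟨hr₁, hr₂⟩ := abs_le.1 hr
  have hut := sq_div_five_le_one_sub_cos ht
  have hu₀ : 0 ≤ 1 - Real.cos t := sub_nonneg.2 (Real.cos_le_one t)
  set u := 1 - Real.cos t
  have hexponent : l * (r - 1 - r * u) + δ * ((r - 1) ^ 2 + 2 * r * u) ≤
      l * (r - 1) + δ * (r - 1) ^ 2 + (-(3 / 10 * l * u) + -(6 / 100 * l) * t ^ 2) := by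
    have hδru : δ * (r * u) ≤ 165 / 1000 * l * (r * u) :=
      mul_le_mul_of_nonneg_right hδ (mul_nonneg (by linarith) hu₀)
    have hlru : l * u * (9 / 10) ≤ l * u * r := by gcongr; linarith
    have hlut : l * (t ^ 2 / 5) ≤ l * u := by gcongr
    linarith [mul_nonneg hl.le hu₀]
  calc δ * ((r - 1) ^ 2 + 2 * r * u) *
        Real.exp (l * (r - 1 - r * u) + δ * ((r - 1) ^ 2 + 2 * r * u))
      ≤ δ * ((r - 1) ^ 2 + 22 / 10 * u) * Real.exp (l * (r - 1) + δ * (r - 1) ^ 2 +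
          (-(3 / 10 * l * u) + -(6 / 100 * l) * t ^ 2)) := by
        gcongr
        linarith
    _ = δ * (((r - 1) ^ 2 + 22 / 10 * u) * Real.exp (-(3 / 10 * l * u))) *
          Real.exp (l * (r - 1) + δ * (r - 1) ^ 2) * Real.exp (-(6 / 100 * l) * t ^ 2) := by
        rw [Real.exp_add, Real.exp_add (-(3 / 10 * l * u))]
        ring
    _ ≤ δ * ((r - 1) ^ 2 + 22 / 10 / (3 / 10 * l)) * Real.exp (l * (r - 1) + δ * (r - 1) ^ 2) *
          Real.exp (-(6 / 100 * l) * t ^ 2) := by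
        gcongr
        exact add_mul_mul_exp_neg_le (sq_nonneg _) (by norm_num) (by positivity) hu₀
    _ ≤ _ := by
        gcongr δ * (_ + ?_) * _ * _
        rw [div_le_div_iff₀ (by positivity) hl]
        linarith

theorem intervalIntegral_gaussian_le (hl : 0 < l) :
    ∫ t in (-π)..π, Real.exp (-(6 / 100 * l) * t ^ 2) ≤ 8 / √l := by
  rw [intervalIntegral.integral_of_le (by linarith [Real.pi_pos])]
  calc ∫ t in Set.Ioc (-π) π, Real.exp (-(6 / 100 * l) * t ^ 2)
      ≤ ∫ t, Real.exp (-(6 / 100 * l) * t ^ 2) :=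
        setIntegral_le_integral (integrable_exp_neg_mul_sq (by positivity))
          (.of_forall fun t => (Real.exp_pos _).le)
    _ = √(π / (6 / 100 * l)) := integral_gaussian _
    _ ≤ √(8 ^ 2 / l) := by
        refine Real.sqrt_le_sqrt ?_
        rw [div_le_div_iff₀ (by positivity) hl]
        nlinarith [Real.pi_lt_d2]
    _ = 8 / √l := by rw [Real.sqrt_div (by norm_num), Real.sqrt_sq (by norm_num)]

theorem two_pi_mul_abs_measureReal_sub_poissonMeasure_le {μ : Measure ℕ} [IsFiniteMeasure μ]
    (hl : 0 < l) (hδ₀ : 0 ≤ δ) (hδ : δ ≤ 165 / 1000 * l) (hr : |r - 1| ≤ 1 / 10)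
    (hμr : Integrable (fun k : ℕ => r ^ k) μ)
    (hμ : ∀ z : ℂ, ‖z‖ = r → ‖pgf μ z - Complex.exp (l * (z - 1))‖ ≤
      δ * ‖z - 1‖ ^ 2 * Real.exp (l * (z - 1).re + δ * ‖z - 1‖ ^ 2)) (x : ℕ) :
    2 * π * r ^ x * |μ.real {x} - (poissonMeasure l.toNNReal).real {x}| ≤
      δ * ((r - 1) ^ 2 + 8 / l) * Real.exp (l * (r - 1) + δ * (r - 1) ^ 2) * (8 / √l) := by
  have hr₀ : 0 ≤ r := by linarith [(abs_le.1 hr).1]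
  have hpi : -π ≤ π := by linarith [Real.pi_pos]
  have hcoe : ((l.toNNReal : NNReal) : ℂ) = l :=
    congrArg ((↑) : ℝ → ℂ) (Real.coe_toNNReal l hl.le)
  have hpoisson := integrable_pow_poissonMeasure l.toNNReal r
  have hcont := (continuous_pgf_circleMap hμr).sub (continuous_pgf_circleMap hpoisson)
  refine (two_pi_mul_abs_measureReal_singleton_sub_le hr₀ hμr hpoisson x).trans ?_
  calc ∫ t in (-π)..π,
        ‖pgf μ (circleMap 0 r t) - pgf (poissonMeasure l.toNNReal) (circleMap 0 r t)‖
      ≤ ∫ t in (-π)..π, δ * ((r - 1) ^ 2 + 8 / l) *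
          Real.exp (l * (r - 1) + δ * (r - 1) ^ 2) * Real.exp (-(6 / 100 * l) * t ^ 2) := by
        refine intervalIntegral.integral_mono_on hpi (hcont.norm.intervalIntegrable _ _)
          (Continuous.intervalIntegrable (by fun_prop) _ _) fun t ht => ?_
        rw [pgf_poissonMeasure, hcoe]
        exact (hμ _ (by rw [norm_circleMap_zero, abs_of_nonneg hr₀])).trans
          (mul_exp_circleMap_le_gaussian hl hδ₀ hδ hr (abs_le.2 ht))
    _ ≤ _ := by
        rw [intervalIntegral.integral_const_mul]
        gcongr
        exact intervalIntegral_gaussian_le hl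

theorem abs_measureReal_div_poissonMeasure_sub_one_le {μ : Measure ℕ} [IsFiniteMeasure μ]
    (hl : 0 < l) (hδ₀ : 0 ≤ δ) (hδ : δ ≤ 165 / 1000 * l) (hr : |r - 1| ≤ 1 / 10)
    (hμr : Integrable (fun k : ℕ => r ^ k) μ)
    (hμ : ∀ z : ℂ, ‖z‖ = r → ‖pgf μ z - Complex.exp (l * (z - 1))‖ ≤
      δ * ‖z - 1‖ ^ 2 * Real.exp (l * (z - 1).re + δ * ‖z - 1‖ ^ 2)) {x : ℕ}
    (hx : (x : ℝ) = l * r) :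
    |μ.real {x} / (poissonMeasure l.toNNReal).real {x} - 1| ≤
      4 * (δ * ((r - 1) ^ 2 + 8 / l)) * Real.exp (δ * (r - 1) ^ 2) := by
  obtain ⟨hr₁, hr₂⟩ := abs_le.1 hr
  have hr₀ : 0 < r := by linarith
  have hdiff := two_pi_mul_abs_measureReal_sub_poissonMeasure_le hl hδ₀ hδ hr hμr hμ x
  have hlower := two_mul_exp_div_sqrt_le_poissonMeasure hl hr₀ (by linarith) hx
  set Q := (poissonMeasure l.toNNReal).real {x}
  have hQ : 0 < Q := poissonMeasure_real_singleton_pos x (Real.toNNReal_pos.2 hl)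
  have hD : 0 < 2 * π * r ^ x := by positivity
  rw [div_sub_one hQ.ne', abs_div, abs_of_pos hQ, div_le_iff₀ hQ, ← mul_le_mul_iff_right₀ hD]
  calc 2 * π * r ^ x * |μ.real {x} - Q|
      ≤ 4 * (δ * ((r - 1) ^ 2 + 8 / l)) * Real.exp (δ * (r - 1) ^ 2) *
          (2 * Real.exp (l * (r - 1)) / √l) := by
        refine hdiff.trans_eq ?_
        rw [Real.exp_add]
        ring
    _ ≤ 4 * (δ * ((r - 1) ^ 2 + 8 / l)) * Real.exp (δ * (r - 1) ^ 2) * (2 * π * r ^ x * Q) := by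
        gcongr
    _ = _ := by ring

end GaussianTransfer

section CramerSeries

theorem abs_tsum_pow_div_le_sq {w : ℝ} (hw : |w| ≤ 1 / 2) :
    |∑' k : ℕ, w ^ (k + 2) / (((k : ℝ) + 2) * ((k : ℝ) + 1))| ≤ w ^ 2 := by
  have hterm (k : ℕ) : ‖w ^ (k + 2) / (((k : ℝ) + 2) * ((k : ℝ) + 1))‖ ≤
      w ^ 2 / 2 * (1 / 2) ^ k := by
    have hden : (2 : ℝ) ≤ ((k : ℝ) + 2) * ((k : ℝ) + 1) := by nlinarith [k.cast_nonneg (α := ℝ)]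
    rw [norm_div, norm_pow, Real.norm_of_nonneg (zero_le_two.trans hden), Real.norm_eq_abs, pow_add,
      sq_abs]
    calc |w| ^ k * w ^ 2 / (((k : ℝ) + 2) * ((k : ℝ) + 1)) ≤ (1 / 2) ^ k * w ^ 2 / 2 := by gcongr
      _ = w ^ 2 / 2 * (1 / 2) ^ k := by ring
  have hsum := tsum_of_norm_bounded (hasSum_geometric_two.mul_left (w ^ 2 / 2)) hterm
  rwa [div_mul_cancel₀ _ two_ne_zero] at hsum

theorem abs_cramerSeries_le {n : ℕ} {ν y : ℝ} (hν₀ : 0 ≤ ν) (hν : ν ≤ 1 / 2) (hy : |y| ≤ 1 / 2) :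
    |cramerSeries n ν y| ≤ 2 * n * ν ^ 2 * y ^ 2 := by
  have hν₁ : 0 < 1 - ν := by linarith
  have hb : |ν / (1 - ν)| ≤ 1 := by
    rw [abs_of_nonneg (by positivity), div_le_one hν₁]
    linarith
  have hw : |ν / (1 - ν) * y| ≤ 1 / 2 := by
    rw [abs_mul]
    exact (mul_le_mul hb hy (abs_nonneg y) zero_le_one).trans_eq (one_mul _)
  simp_rw [cramerSeries, ← mul_div_assoc, ← mul_pow]
  rw [abs_mul, abs_mul, abs_neg, Nat.abs_cast, abs_of_pos hν₁]
  calc _ ≤ n * (1 - ν) * (ν / (1 - ν) * y) ^ 2 := by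
        gcongr
        exact abs_tsum_pow_div_le_sq hw
    _ = n * ν ^ 2 * y ^ 2 / (1 - ν) := by
        field_simp
    _ ≤ 2 * n * ν ^ 2 * y ^ 2 := by
        rw [div_le_iff₀ hν₁]
        nlinarith [show 0 ≤ n * ν ^ 2 * y ^ 2 by positivity]

end CramerSeries

section CorrectionFactor

theorem exists_abs_le_one_and_eq_mul_one_add {R G B : ℝ} (h : |R - G| ≤ B * G) :
    ∃ θ : ℝ, |θ| ≤ 1 ∧ R = G * (1 + θ * B) := by
  have hBG : 0 ≤ B * G := (abs_nonneg _).trans h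
  refine ⟨(R - G) / (B * G), ?_, ?_⟩
  · rw [abs_div, abs_of_nonneg hBG]
    exact div_le_one_of_le₀ h hBG
  · have hcancel : (R - G) / (B * G) * (B * G) = R - G :=
      div_mul_cancel_of_imp fun h₀ => abs_nonpos_iff.1 (h.trans_eq h₀)
    linarith

theorem exp_le_one_add_two_mul {s : ℝ} (hs₀ : 0 ≤ s) (hs : s ≤ 1) : Real.exp s ≤ 1 + 2 * s := by
  have h := (abs_le.1 (Real.abs_exp_sub_one_le (abs_le.2 ⟨by linarith, hs⟩))).2
  rw [abs_of_nonneg hs₀] at h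
  linarith

variable {Λ s : ℝ} {n : ℕ}

theorem exp_le_exp_mul_one_add_pow (hs₀ : 0 ≤ s) (hs : 20 * s ≤ 1) (hΛ : |Λ| ≤ n * s) :
    Real.exp (19 * (n * s)) ≤ Real.exp Λ * (1 + 40 * s) ^ n := by
  calc Real.exp (19 * (n * s)) ≤ Real.exp (Λ + n * (20 * s)) :=
        Real.exp_le_exp.2 (by linarith [(abs_le.1 hΛ).1])
    _ = Real.exp Λ * Real.exp (20 * s) ^ n := by rw [Real.exp_add, Real.exp_nat_mul]
    _ ≤ Real.exp Λ * (1 + 40 * s) ^ n := by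
        gcongr
        linarith [exp_le_one_add_two_mul (by positivity) hs]

theorem exp_mul_one_add_pow_le_exp (hs₀ : 0 ≤ s) (hΛ : |Λ| ≤ n * s) :
    Real.exp Λ * (1 + 40 * s) ^ n ≤ Real.exp (41 * (n * s)) := by
  calc Real.exp Λ * (1 + 40 * s) ^ n ≤ Real.exp Λ * Real.exp (40 * s) ^ n := by
        gcongr
        linarith [Real.add_one_le_exp (40 * s)]
    _ = Real.exp (Λ + n * (40 * s)) := by rw [Real.exp_add, Real.exp_nat_mul]
    _ ≤ Real.exp (41 * (n * s)) := Real.exp_le_exp.2 (by linarith [(abs_le.1 hΛ).2])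

theorem abs_sub_exp_mul_one_add_pow_le {R A : ℝ} (hs₀ : 0 ≤ s) (hs : 20 * s ≤ 1)
    (hΛ : |Λ| ≤ n * s) (hA : 0 ≤ A)
    (hR : |R - 1| ≤ 600 * (A + n * s) * Real.exp (19 * (n * s))) :
    |R - Real.exp Λ * (1 + 40 * s) ^ n| ≤
      700 * (A + n * s) * (Real.exp Λ * (1 + 40 * s) ^ n) := by
  have hlower := exp_le_exp_mul_one_add_pow hs₀ hs hΛ
  have hupper := exp_mul_one_add_pow_le_exp hs₀ hΛ
  set G := Real.exp Λ * (1 + 40 * s) ^ n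
  have hG₁ : 1 ≤ G := (Real.one_le_exp (by positivity)).trans hlower
  have hAG : 0 ≤ A * G := by positivity
  have hsG : 0 ≤ n * s * G := by positivity
  calc |R - G| ≤ |R - 1| + |1 - G| := abs_sub_le R 1 G
    _ = |R - 1| + (G - 1) := by rw [abs_sub_comm 1 G, abs_of_nonneg (sub_nonneg.2 hG₁)]
    _ ≤ 600 * (A + n * s) * G + 41 * (n * s) * G := by
        gcongr
        · exact hR.trans (by gcongr)
        · exact sub_one_le_mul_of_le_exp (by linarith) hupper
    _ ≤ 700 * (A + n * s) * G := by linarith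

end CorrectionFactor

section LocalLimit

variable {Ω : Type*} [MeasurableSpace Ω] {P : Measure Ω} {X : ℕ → Ω → ℕ}
  {n : ℕ} {ν₁ ν₂ ν₁₂ γ : ℝ}

theorem integrable_pow_map_sum [IsFiniteMeasure P] (hX : ∀ i ∈ Finset.Icc 1 n, Measurable (X i))
    {r s L : ℝ} (hrs : |r| ≤ s) (hL : ∀ i ∈ Finset.Icc 1 n, ∀ᵐ ω ∂P, s ^ X i ω ≤ L) :
    Integrable (fun k : ℕ => r ^ k) (P.map fun ω => ∑ i ∈ Finset.Icc 1 n, X i ω) := by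
  have hS : Measurable fun ω => ∑ i ∈ Finset.Icc 1 n, X i ω := Finset.measurable_fun_sum _ hX
  rw [integrable_map_measure (by fun_prop) hS.aemeasurable]
  refine Integrable.of_bound (C := L ^ n) (Measurable.of_discrete.comp hS).aestronglyMeasurable ?_
  filter_upwards [(Finset.eventually_all _).2 hL] with ω hω
  calc ‖r ^ ∑ i ∈ Finset.Icc 1 n, X i ω‖ = ∏ i ∈ Finset.Icc 1 n, |r| ^ X i ω := by
        rw [← Finset.prod_pow_eq_pow_sum, norm_prod]
        simp_rw [norm_pow, Real.norm_eq_abs]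
    _ ≤ ∏ _i ∈ Finset.Icc 1 n, L := by
        gcongr with i hi
        exact (by gcongr : |r| ^ X i ω ≤ s ^ X i ω).trans (hω i hi)
    _ = L ^ n := by simp

theorem pow_le_exp_div_ten {C : ℝ} {k : ℕ} (hk : k ≤ C) :
    (11 / 10 : ℝ) ^ k ≤ Real.exp (C / 10) := by
  calc (11 / 10 : ℝ) ^ k ≤ Real.exp (1 / 10) ^ k := by
        gcongr
        linarith [Real.add_one_le_exp (1 / 10 : ℝ)]
    _ = Real.exp (k * (1 / 10)) := (Real.exp_nat_mul _ _).symm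
    _ ≤ Real.exp (C / 10) := Real.exp_le_exp.2 (by linarith)

theorem two_mul_exp_div_ten_sq_le {C : ℝ} (hC : 1 ≤ C) :
    2 * Real.exp (C / 10) ^ 2 ≤ Real.exp (1.5 * C) := by
  calc 2 * Real.exp (C / 10) ^ 2 ≤ Real.exp (1.3 * C) * Real.exp (C / 10) ^ 2 := by
        gcongr
        linarith [Real.add_one_le_exp (1.3 * C)]
    _ = Real.exp (1.5 * C) := by
        rw [← Real.exp_nat_mul, ← Real.exp_add]
        congr 1
        push_cast
        ring

theorem exp_div_ten_cube_le {C : ℝ} (hC : 0 ≤ C) :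
    Real.exp (C / 10) ^ 3 ≤ Real.exp (1.5 * C) := by
  rw [← Real.exp_nat_mul]
  exact Real.exp_le_exp.2 (by push_cast; linarith)

theorem stepError_le {C : ℝ} (hC : 1 ≤ C) (hν₂ : 0 ≤ ν₂) (hν₁₂ : 0 ≤ ν₁₂) :
    Real.exp (C / 10) * ν₂ + 3 * (Real.exp (C / 10) ^ 2 * ν₁₂) +
        13 * (Real.exp (C / 10) ^ 3 * ν₁ ^ 2) ≤
      Real.exp (1.5 * C) * (ν₂ / 2 + 3 / 2 * ν₁₂ + 13 * ν₁ ^ 2) := by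
  have hL : 1 ≤ Real.exp (C / 10) := Real.one_le_exp (by linarith)
  have hL₂ := two_mul_exp_div_ten_sq_le hC
  have hL₃ := exp_div_ten_cube_le (by linarith : 0 ≤ C)
  set L := Real.exp (C / 10)
  set E := Real.exp (1.5 * C)
  have hLν₂ : 2 * L * ν₂ ≤ E * ν₂ := by gcongr; nlinarith
  have hLν₁₂ : 2 * L ^ 2 * ν₁₂ ≤ E * ν₁₂ := by gcongr
  have hLν₁ : L ^ 3 * ν₁ ^ 2 ≤ E * ν₁ ^ 2 := by gcongr
  linarith

theorem gaussianError_le {ε y : ℝ} (hn : n ≠ 0) (hν₁ : 0 < ν₁) (hγ : 0 ≤ γ) (hε : ε ≤ 15 * γ) :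
    4 * (11 / 10 * n * ε * (y ^ 2 + 8 / (n * ν₁))) ≤ 600 * (γ * ν₁⁻¹ + n * (γ * y ^ 2)) := by
  have hγy : 0 ≤ n * (γ * y ^ 2) := by positivity
  have hγν : 0 ≤ γ * ν₁⁻¹ := by positivity
  calc 4 * (11 / 10 * n * ε * (y ^ 2 + 8 / (n * ν₁))) ≤
        4 * (11 / 10 * n * (15 * γ) * (y ^ 2 + 8 / (n * ν₁))) := by gcongr
    _ = 528 * (γ * ν₁⁻¹) + 66 * (n * (γ * y ^ 2)) := by
        field_simp
        ring
    _ ≤ 600 * (γ * ν₁⁻¹ + n * (γ * y ^ 2)) := by linarith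

theorem abs_measureReal_sum_div_poissonMeasure_sub_one_le [IsProbabilityMeasure P] {C₀ : ℝ}
    (hn : n ≠ 0) (hC₀ : 1 ≤ C₀) (hX : ∀ i ∈ Finset.Icc 1 n, Measurable (X i))
    (hdep : IsMDependent 1 n X P) (hC : ∀ i ∈ Finset.Icc 1 n, ∀ᵐ ω ∂P, (X i ω : ℝ) ≤ C₀)
    (hν₁₀ : 0 < ν₁) (hν₁ : ∀ i ∈ Finset.Icc 1 n, ∫ ω, (X i ω : ℝ) ∂P = ν₁) (hν₂₀ : 0 ≤ ν₂)
    (hν₂ : ∀ i ∈ Finset.Icc 1 n, ∫ ω, (X i ω : ℝ) * (X i ω - 1) ∂P ≤ ν₂) (hν₁₂₀ : 0 ≤ ν₁₂)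
    (hν₁₂ : ∀ i, 1 ≤ i → i < n → ∫ ω, (X i ω : ℝ) * X (i + 1) ω ∂P ≤ ν₁₂)
    (hEν₁ : Real.exp (1.5 * C₀) * ν₁ ≤ 2 / 1000) (hEν₂ : Real.exp (1.5 * C₀) * ν₂ ≤ ν₁ / 20)
    (hEν₁₂ : Real.exp (1.5 * C₀) * ν₁₂ ≤ ν₁ / 20) (hγ₁ : Real.exp (1.5 * C₀) * ν₁ ^ 2 ≤ γ)
    (hγ₂ : Real.exp (1.5 * C₀) * ν₂ ≤ γ) (hγ₁₂ : Real.exp (1.5 * C₀) * ν₁₂ ≤ γ) {x : ℕ} {y : ℝ}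
    (hy : |y| ≤ 1 / 10) (hx : (x : ℝ) = n * ν₁ * (1 + y)) :
    |P.real {ω | ∑ i ∈ Finset.Icc 1 n, X i ω = x} /
        (poissonMeasure (n * ν₁).toNNReal).real {x} - 1| ≤
      600 * (γ * ν₁⁻¹ + n * (γ * y ^ 2)) * Real.exp (19 * (n * (γ * y ^ 2))) := by
  have hl : 0 < n * ν₁ := by positivity
  have hS : Measurable fun ω => ∑ i ∈ Finset.Icc 1 n, X i ω := Finset.measurable_fun_sum _ hX
  have hL : ∀ i ∈ Finset.Icc 1 n, ∀ᵐ ω ∂P, (11 / 10 : ℝ) ^ X i ω ≤ Real.exp (C₀ / 10) :=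
    fun i hi => (hC i hi).mono fun ω hω => pow_le_exp_div_ten hω
  have hL₁ : 1 ≤ Real.exp (C₀ / 10) := Real.one_le_exp (by linarith)
  have hL₂ := two_mul_exp_div_ten_sq_le hC₀
  have hε := stepError_le (ν₁ := ν₁) hC₀ hν₂₀ hν₁₂₀
  have hE : 0 < Real.exp (1.5 * C₀) := Real.exp_pos _
  set L := Real.exp (C₀ / 10)
  set E := Real.exp (1.5 * C₀)
  set ε := L * ν₂ + 3 * (L ^ 2 * ν₁₂) + 13 * (L ^ 3 * ν₁ ^ 2)
  have hγ₀ : 0 ≤ γ := le_trans (by positivity) hγ₁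
  have hε₀ : 0 ≤ ε := by positivity
  have hεν₁ : ε ≤ 15 / 100 * ν₁ := by nlinarith
  have hεγ : ε ≤ 15 * γ := by linarith
  have hr : |1 + y - 1| ≤ 1 / 10 := by rwa [add_sub_cancel_left]
  obtain ⟨hy₁, hy₂⟩ := abs_le.1 hy
  have : IsProbabilityMeasure (P.map fun ω => ∑ i ∈ Finset.Icc 1 n, X i ω) :=
    Measure.isProbabilityMeasure_map hS.aemeasurable
  have hratio := abs_measureReal_div_poissonMeasure_sub_one_le hl (δ := 11 / 10 * n * ε)
    (mul_nonneg (by positivity) hε₀) (by nlinarith [(Nat.cast_nonneg n : (0 : ℝ) ≤ n)]) hr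
    (integrable_pow_map_sum hX (abs_le.2 ⟨by linarith, by linarith⟩) hL)
    (fun z hz => by
      simpa using norm_pgf_sum_sub_exp_le hX hdep hL₁ hL hν₁₀.le hν₁ hν₂₀ hν₂ hν₁₂₀ hν₁₂
        (by nlinarith) (by nlinarith) le_rfl (hz.trans_le (by linarith))) hx
  rw [map_measureReal_apply hS (measurableSet_singleton x), add_sub_cancel_left] at hratio
  have hexponent : 11 / 10 * n * ε * y ^ 2 ≤ 19 * (n * (γ * y ^ 2)) := by
    calc 11 / 10 * n * ε * y ^ 2 ≤ 11 / 10 * n * (15 * γ) * y ^ 2 := by gcongr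
      _ ≤ 19 * (n * (γ * y ^ 2)) := by linarith [show 0 ≤ n * (γ * y ^ 2) by positivity]
  exact hratio.trans (mul_le_mul (gaussianError_le hn hν₁₀ hγ₀ hεγ) (Real.exp_le_exp.2 hexponent)
    (Real.exp_nonneg _) (by positivity))

theorem exp_mul_le_div {a b c d : ℝ} (h : b ≤ c * Real.exp (-a) / d) :
    Real.exp a * b ≤ c / d := by
  calc Real.exp a * b ≤ Real.exp a * (c * Real.exp (-a) / d) := by gcongr
    _ = c / d := by rw [Real.exp_neg]; field_simp

end LocalLimit

theorem theorem1_general {Ω : Type*} [MeasurableSpace Ω] {P : Measure Ω} [IsProbabilityMeasure P]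
    {n : ℕ} {X : ℕ → Ω → ℕ} {x : ℕ} {C₀ ν₁ ν₂ ν₁₂ y γ : ℝ} (hn : 2 ≤ n) (hC₀ : 1 ≤ C₀)
    (hX : ∀ i ∈ Finset.Icc 1 n, Measurable (X i)) (hdep : IsMDependent 1 n X P)
    (hν₁ : ∀ i ∈ Finset.Icc 1 n, ∫ ω, (X i ω : ℝ) ∂P = ν₁)
    (hν₂ : ∀ i ∈ Finset.Icc 1 n, ∫ ω, (X i ω : ℝ) * ((X i ω : ℝ) - 1) ∂P ≤ ν₂)
    (hν₁₂ : ∀ i, 1 ≤ i → i + 1 ≤ n → ∫ ω, (X i ω : ℝ) * (X (i + 1) ω : ℝ) ∂P ≤ ν₁₂)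
    (hy : y = (x - n * ν₁) / (n * ν₁))
    (hγ : γ = Real.exp (1.5 * C₀) * max (ν₁ ^ 2) (max ν₂ ν₁₂)) (hν₁₀ : 0 < ν₁)
    (hC : ∀ i ∈ Finset.Icc 1 n, ∀ᵐ ω ∂P, (X i ω : ℝ) ≤ C₀)
    (hEν₁ : Real.exp (1.5 * C₀) * ν₁ ≤ 0.002) (hy_le : |y| ≤ 1 / 10)
    (hν₂_le : ν₂ ≤ ν₁ * Real.exp (-(1.5 * C₀)) / 20)
    (hν₁₂_le : ν₁₂ ≤ ν₁ * Real.exp (-(1.5 * C₀)) / 20) :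
    ∃ θ : ℝ, |θ| ≤ 1 ∧
      P.real {ω | ∑ i ∈ Finset.Icc 1 n, X i ω = x} /
          (poissonMeasure (n * ν₁).toNNReal).real {x} =
        Real.exp (cramerSeries n ν₁ y) * (1 + 40 * γ * y ^ 2) ^ n *
          (1 + θ * 700 * γ * (ν₁⁻¹ + n * y ^ 2)) := by
  have hν₂₀ : 0 ≤ ν₂ := (integral_nonneg fun ω => natCast_mul_sub_one_nonneg _).trans
    (hν₂ 1 (Finset.mem_Icc.2 ⟨le_rfl, by omega⟩))
  have hν₁₂₀ : 0 ≤ ν₁₂ := (integral_nonneg fun ω => by positivity).trans (hν₁₂ 1 le_rfl hn)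
  have hE : 2 ≤ Real.exp (1.5 * C₀) := by linarith [Real.add_one_le_exp (1.5 * C₀)]
  have hEν₂ := exp_mul_le_div hν₂_le
  have hEν₁₂ := exp_mul_le_div hν₁₂_le
  rw [mul_max_of_nonneg _ _ (Real.exp_nonneg _), mul_max_of_nonneg _ _ (Real.exp_nonneg _)] at hγ
  have hγ₁ : Real.exp (1.5 * C₀) * ν₁ ^ 2 ≤ γ := hγ ▸ le_max_left _ _
  have hγ₂ : Real.exp (1.5 * C₀) * ν₂ ≤ γ := hγ ▸ le_max_of_le_right (le_max_left _ _)
  have hγ₁₂ : Real.exp (1.5 * C₀) * ν₁₂ ≤ γ := hγ ▸ le_max_of_le_right (le_max_right _ _)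
  have hν₁_le : ν₁ ≤ 1 / 1000 := by nlinarith
  have hγ_le : γ ≤ ν₁ / 20 := hγ ▸ max_le (by nlinarith) (max_le hEν₂ hEν₁₂)
  have hγ₀ : 0 ≤ γ := le_trans (by positivity) hγ₁
  have hy_sq : y ^ 2 ≤ 1 := by nlinarith [abs_le.1 hy_le]
  have hx : (x : ℝ) = n * ν₁ * (1 + y) := by
    have hl : n * ν₁ ≠ 0 := by positivity
    rw [hy, one_add_div hl, mul_div_cancel₀ _ hl, add_sub_cancel]
  have hratio := abs_measureReal_sum_div_poissonMeasure_sub_one_le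
    (by omega) hC₀ hX hdep hC hν₁₀ hν₁ hν₂₀ hν₂ hν₁₂₀ hν₁₂ (by linarith) hEν₂ hEν₁₂ hγ₁ hγ₂ hγ₁₂
    hy_le hx
  have hΛ : |cramerSeries n ν₁ y| ≤ n * (γ * y ^ 2) := by
    calc |cramerSeries n ν₁ y| ≤ 2 * n * ν₁ ^ 2 * y ^ 2 :=
          abs_cramerSeries_le hν₁₀.le (by linarith) (by linarith)
      _ = n * (2 * ν₁ ^ 2 * y ^ 2) := by ring
      _ ≤ n * (γ * y ^ 2) := by
          gcongr
          exact le_trans (by gcongr) hγ₁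
  obtain ⟨θ, hθ, heq⟩ := exists_abs_le_one_and_eq_mul_one_add
    (abs_sub_exp_mul_one_add_pow_le (by positivity) (by nlinarith) hΛ (by positivity) hratio)
  refine ⟨θ, hθ, heq.trans ?_⟩
  rw [← mul_assoc 40]
  ring

theorem theorem1 :
    -- the constants are absolute: chosen before all other data
    ∃ C₁ C₂ : ℝ, 0 < C₁ ∧ 0 < C₂ ∧
      ∀ {Ω : Type*} [MeasurableSpace Ω] (P : Measure Ω) [IsProbabilityMeasure P]
        (n : ℕ) (X : ℕ → Ω → ℕ) (x : ℕ) (C₀ ν₁ ν₂ ν₁₂ y γ : ℝ),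
        2 ≤ n → 1 ≤ x → 1 ≤ C₀ →
        -- `X 1, …, X n` are identically distributed and 1-dependent
        (∀ i ∈ Finset.Icc 1 n, Measurable (X i)) →
        (∀ i ∈ Finset.Icc 1 n, IdentDistrib (X i) (X 1) P P) →
        IsMDependent 1 n X P →
        -- the moments `E X₁`, `E X₁ (X₁ - 1)`, `E X₁ X₂`
        ν₁ = ∫ ω, (X 1 ω : ℝ) ∂P →
        ν₂ = ∫ ω, (X 1 ω : ℝ) * ((X 1 ω : ℝ) - 1) ∂P →
        ν₁₂ = ∫ ω, (X 1 ω : ℝ) * (X 2 ω : ℝ) ∂P →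
        -- no adjacent pair has a larger mixed moment than the first one
        (∀ i : ℕ, 1 ≤ i → i + 1 ≤ n →
          ∫ ω, (X i ω : ℝ) * (X (i + 1) ω : ℝ) ∂P ≤ ν₁₂) →
        y = ((x : ℝ) - n * ν₁) / (n * ν₁) →
        γ = Real.exp (1.5 * C₀) * max (ν₁ ^ 2) (max ν₂ ν₁₂) →
        -- smallness and boundedness conditions
        0 < ν₁ →
        (∀ᵐ ω ∂P, (X 1 ω : ℝ) ≤ C₀) →
        Real.exp (5 * C₀) * ν₁ ≤ 0.002 →
        |y| ≤ 1 / 10 →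
        ν₂ ≤ ν₁ * Real.exp (-(1.5 * C₀)) / 20 →
        ν₁₂ ≤ ν₁ * Real.exp (-(1.5 * C₀)) / 20 →
        ∃ θ : ℝ, |θ| ≤ 1 ∧
          P.real {ω | ∑ i ∈ Finset.Icc 1 n, X i ω = x} /
              (poissonMeasure (Real.toNNReal (n * ν₁))).real {x} =
            Real.exp (cramerSeries n ν₁ y) * (1 + C₁ * γ * y ^ 2) ^ n *
              (1 + θ * C₂ * γ * (ν₁⁻¹ + n * y ^ 2)) := by
  refine ⟨40, 700, by norm_num, by norm_num, ?_⟩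
  intro Ω _ P _ n X x C₀ ν₁ ν₂ ν₁₂ y γ hn _ hC₀ hX hid hdep hν₁ hν₂ _ hν₁₂ hy hγ hν₁₀ hC hEν₁ hy_le
    hν₂_le hν₁₂_le
  have hmoment (f : ℕ → ℝ) (i : ℕ) (hi : i ∈ Finset.Icc 1 n) :
      ∫ ω, f (X i ω) ∂P = ∫ ω, f (X 1 ω) ∂P :=
    ((hid i hi).comp Measurable.of_discrete).integral_eq
  have hexp : Real.exp (1.5 * C₀) ≤ Real.exp (5 * C₀) := Real.exp_le_exp.2 (by linarith)
  exact theorem1_general hn hC₀ hX hdep (fun i hi => (hmoment (fun k => k) i hi).trans hν₁.symm)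
    (fun i hi => ((hmoment (fun k => k * (k - 1)) i hi).trans hν₂.symm).le) hν₁₂ hy hγ hν₁₀
    (fun i hi => (hid i hi).symm.ae_snd (p := fun k : ℕ => (k : ℝ) ≤ C₀)
      MeasurableSet.of_discrete hC)
    ((mul_le_mul_of_nonneg_right hexp hν₁₀.le).trans hEν₁) hy_le hν₂_le hν₁₂_le
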